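/- Theorem 3.3. Let $K$ be an algebraically closed field of characteristic $0$. Let $u(x,y,z)\in K[x,y,z]$, $v(x,y,w)\in K[x,y,w]$ and $h(x,y)\in K[x,y]$, and let $$H=\bigl(u(x,y,z),\;v(x,y,u(x,y,z)),\;h(x,y)\bigr),$$ regarded as a polynomial map $K^3\to K^3$. Assume that $H(0)=0$, that the three components of $H$ are linearly independent over $K$, that the Jacobian matrix $JH$ is nilpotent, and that $\gcd(\deg v(x,y,0),\deg h)\le 3$, where $\deg$ is the total degree and $v(x,y,0)$ is obtained from $v(x,y,w)$ by putting $w=0$. Then there is $T\in \mathrm{GL}_3(K)$ such that $T^{-1}\circ H\circ T=(\tilde u,\tilde v,\tilde h)$ with $$\tilde u=u_1z-a^{-1}b'(y)\,g(ax+b(y))-u_1l_2y,\qquad \tilde v=g(ax+b(y)),\qquad \tilde h=c_0\tilde v^2+l_2\tilde v,$$ where $b(y)=u_1c_0a\,y^2+l_1y+\tilde l_2$ for some $u_1,c_0,a\in K\setminus\{0\}$, $l_1,l_2,\tilde l_2\in K$, and $g(t)\in K[t]$ satisfies $g(0)=0$ and $\deg g\ge 1$. -/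

import Mathlib

namespace NilpJac

noncomputable section

/-- Polynomial maps `K³ → K³`, with `x = X 0`, `y = X 1`, `z = X 2`. -/
abbrev PolyMap (K : Type*) [Field K] : Type _ :=
  Fin 3 → MvPolynomial (Fin 3) K

/-- The Jacobian matrix `(∂ Hᵢ / ∂ xⱼ)`. -/
def jacobian {K : Type*} [Field K] (H : PolyMap K) :
    Matrix (Fin 3) (Fin 3) (MvPolynomial (Fin 3) K) :=
  Matrix.of fun i j => MvPolynomial.pderiv j (H i)

/-- The map `(u(x,y,z), v(x,y,u(x,y,z)), h(x,y))`. The third variable of `v` is the slot into which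
`u` is substituted. -/
def mapOf {K : Type*} [Field K] (u v : MvPolynomial (Fin 3) K)
    (h : MvPolynomial (Fin 2) K) : PolyMap K :=
  ![u,
    MvPolynomial.bind₁ ![MvPolynomial.X 0, MvPolynomial.X 1, u] v,
    MvPolynomial.bind₁ ![MvPolynomial.X 0, MvPolynomial.X 1] h]

/-- The polynomial `v(x,y,0)` in the two variables `x = X 0`, `y = X 1`. -/
def atZero {K : Type*} [Field K] (v : MvPolynomial (Fin 3) K) : MvPolynomial (Fin 2) K :=
  MvPolynomial.bind₁ ![MvPolynomial.X 0, MvPolynomial.X 1, 0] v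

/-- The composition `T⁻¹ ∘ H ∘ T`, with `T` acting on column vectors. -/
def conj {K : Type*} [Field K] (T : Matrix.GeneralLinearGroup (Fin 3) K) (H : PolyMap K) :
    PolyMap K :=
  fun i => ∑ j : Fin 3, MvPolynomial.C ((T⁻¹).val i j) *
    MvPolynomial.bind₁
      (fun k : Fin 3 => ∑ l : Fin 3, MvPolynomial.C (T.val k l) * MvPolynomial.X l) (H j)

/-- `H = (u₁z - a⁻¹b'(y)g(ax+b(y)) - u₁l₂y, g(ax+b(y)), c₀v² + l₂v)`, where `v` is the second
component and `b(y) = u₁c₀ay² + l₁y + m₂`, for some `u₁, c₀, a ∈ K*`, `l₁, l₂, m₂ ∈ K` and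
`g ∈ K[t]` with `g(0) = 0`, `deg g ≥ 1`. -/
def HasNormalForm {K : Type*} [Field K] (H : PolyMap K) : Prop :=
  ∃ (u₁ c₀ a l₁ l₂ m₂ : K) (g b : Polynomial K) (s : MvPolynomial (Fin 3) K),
    u₁ ≠ 0 ∧ c₀ ≠ 0 ∧ a ≠ 0 ∧ g.eval 0 = 0 ∧ 1 ≤ g.natDegree ∧
    b = Polynomial.C (u₁ * c₀ * a) * Polynomial.X ^ 2 + Polynomial.C l₁ * Polynomial.X +
      Polynomial.C m₂ ∧
    s = MvPolynomial.C a * MvPolynomial.X 0 + Polynomial.aeval (MvPolynomial.X 1) b ∧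
    H 0 = MvPolynomial.C u₁ * MvPolynomial.X 2
      - MvPolynomial.C a⁻¹ * Polynomial.aeval (MvPolynomial.X 1) (Polynomial.derivative b) *
          Polynomial.aeval s g
      - MvPolynomial.C (u₁ * l₂) * MvPolynomial.X 1 ∧
    H 1 = Polynomial.aeval s g ∧
    H 2 = MvPolynomial.C c₀ * H 1 ^ 2 + MvPolynomial.C l₂ * H 1

end

end NilpJac

/-! Regard `u` and `v` as polynomials in their last variable over `K[x, y]`. Nilpotency makes the
trace, the sum of the principal minors of size two and the determinant of the Jacobian matrix
vanish. The determinant is `u_z` times an expression composed with `u`, so it reduces to `v_x h_y =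
v_y h_x`. Comparing degrees in `z` gives `deg_w v ≤ 1` (`natDegree_le_one`). The top coefficients in
`z` form a planar nilpotent pair, which forces the coefficient of `w` in `v` to be a constant `c`
(`coeff_one_eq_C`). The linear change `y ↦ y + c x` then leaves `v ∈ K[x, y]`, and `u = k z + φ`
(`linear_of_C`), since otherwise `h` would be affine in `v`.

There remain `φ_x = -v_y`, `φ_y v_x + k h_x = -v_y²` and `v_x h_y = v_y h_x`. Let `σ = -v_y / v_x`
be the slope `dx/dy` of the level curves of `v` and `D = ∂_y + σ ∂_x` the derivative along them.
Equality of the mixed derivatives of `φ` gives `D σ = -k (h_x / v_x)_x / v_x`. The operation `a ↦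
a_x / v_x` preserves functions constant along the level curves (`slope_div`), so `D (D σ) = 0`: the
level curves are parabolas `x = s y² + l y + n` with `s`, `l`, `n` killed by `D`. As `v(s t² + l t +
n, t)` does not depend on `t`, first `s` and then `l` is algebraic over `K`, hence in `K`
(`slope_eq_of_constant_curvature`). So `v` is a polynomial in `x - S y² - L y`, and `φ` and `h`
follow by integration (`exists_normal_data`). -/

namespace NilpJac

noncomputable section

section

/-! ### Partial derivatives in characteristic zero -/

section Pderiv

open MvPolynomial

variable {σ K : Type*} [Field K] [CharZero K]

theorem pderiv_eq_zero_iff_degreeOf {i : σ} {f : MvPolynomial σ K} :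
    pderiv i f = 0 ↔ degreeOf i f = 0 := by
  classical
  constructor
  · intro h
    rw [← Nat.le_zero, degreeOf_le_iff]
    intro m hm
    by_contra hmi
    have h1 := coeff_pderiv (i := i) f (m - Finsupp.single i 1)
    have h2 : m - Finsupp.single i 1 + Finsupp.single i 1 = m :=
      tsub_add_cancel_of_le (Finsupp.single_le_iff.2 (by omega))
    rw [h, h2, coeff_zero] at h1
    rcases mul_eq_zero.1 h1.symm with h3 | h3
    · exact (mem_support_iff.1 hm) h3
    · exact Nat.cast_add_one_ne_zero _ h3
  · intro h
    ext m
    rw [coeff_pderiv, coeff_zero]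
    by_contra h0
    have := monomial_le_degreeOf i (mem_support_iff.2 (left_ne_zero_of_mul h0))
    simp at this
    omega

theorem degreeOf_pderiv_lt {i : σ} {f : MvPolynomial σ K} (h : pderiv i f ≠ 0) :
    degreeOf i (pderiv i f) < degreeOf i f := by
  classical
  have hf : 0 < degreeOf i f := Nat.pos_of_ne_zero fun h0 => h (pderiv_eq_zero_iff_degreeOf.2 h0)
  rw [degreeOf_lt_iff hf]
  intro m hm
  have h1 := coeff_pderiv (i := i) f m
  have h2 : coeff (m + Finsupp.single i 1) f ≠ 0 := by
    intro h0
    rw [h0, zero_mul] at h1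
    exact mem_support_iff.1 hm h1
  have := monomial_le_degreeOf i (mem_support_iff.2 h2)
  simp at this
  omega

/-- Degrees in a single variable add over a domain, so a factor involving `xᵢ` would make the
product involve it. -/
theorem pderiv_eq_zero_of_mul_left {i : σ} {f g : MvPolynomial σ K} (hf : f ≠ 0) (hg : g ≠ 0)
    (h : pderiv i (f * g) = 0) : pderiv i f = 0 := by
  rw [pderiv_eq_zero_iff_degreeOf, degreeOf_mul_eq hf hg] at h
  rw [pderiv_eq_zero_iff_degreeOf]
  omega

theorem pderiv_eq_zero_of_dvd {i : σ} {f : MvPolynomial σ K} (h : f ∣ pderiv i f) :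
    pderiv i f = 0 := by
  by_contra h0
  obtain ⟨g, hg⟩ := h
  have h1 := degreeOf_pderiv_lt h0
  rw [hg, degreeOf_mul_eq (by rintro rfl; simp at hg; exact h0 (by simp))
    (by rintro rfl; simp at hg; exact h0 hg)] at h1
  omega

theorem eq_C_of_pderiv_eq_zero {f : MvPolynomial (Fin 2) K} (h0 : pderiv 0 f = 0)
    (h1 : pderiv 1 f = 0) : ∃ c, f = C c := by
  refine ⟨coeff 0 f, ?_⟩
  rw [pderiv_eq_zero_iff_degreeOf, ← Nat.le_zero, degreeOf_le_iff] at h0 h1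
  ext m
  rw [coeff_C]
  split_ifs with hm
  · rw [hm]
  · by_contra hne
    refine hm (Finsupp.ext fun i => ?_)
    fin_cases i
    · exact (Nat.le_zero.1 (h0 m (mem_support_iff.2 hne))).symm
    · exact (Nat.le_zero.1 (h1 m (mem_support_iff.2 hne))).symm

theorem pderiv_comm {σ K : Type*} [Field K] {i j : σ} (f : MvPolynomial σ K) :
    pderiv i (pderiv j f) = pderiv j (pderiv i f) := by
  classical
  ext m
  simp only [coeff_pderiv]
  rcases eq_or_ne i j with rfl | h
  · rfl
  · simp [add_right_comm, h, h.symm]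
    ring_nf

end Pderiv

/-! ### Derivations acting on coefficients -/

section CoeffDer

open Polynomial

variable {R A : Type*} [CommRing R] [CommRing A] [Algebra R A]

/-- The derivation of `A[X]` acting on coefficients by `d` and killing `X`. -/
def coeffDer (d : Derivation R A A) : Derivation R A[X] A[X] :=
  PolynomialModule.equivPolynomialSelf.compDer d.mapCoeffs

@[simp]
theorem coeff_coeffDer (d : Derivation R A A) (p : A[X]) (n : ℕ) :
    (coeffDer d p).coeff n = d (p.coeff n) := rfl

@[simp]
theorem coeffDer_C (d : Derivation R A A) (a : A) : coeffDer d (C a) = C (d a) := by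
  ext n
  rw [coeff_coeffDer, coeff_C, coeff_C]
  split_ifs <;> simp

@[simp]
theorem coeffDer_X (d : Derivation R A A) : coeffDer d (X : A[X]) = 0 := by
  ext n
  rw [coeff_coeffDer, coeff_X]
  split_ifs <;> simp

theorem coeffDer_comp (d : Derivation R A A) (p q : A[X]) :
    coeffDer d (p.comp q) = (coeffDer d p).comp q + (derivative p).comp q * coeffDer d q := by
  induction p using Polynomial.induction_on' with
  | add p r hp hr => simp only [add_comp, map_add, hp, hr]; ring
  | monomial n a =>
    rw [← C_mul_X_pow_eq_monomial]
    simp [Derivation.leibniz, Derivation.leibniz_pow, derivative_X_pow]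
    ring

/-- Derivations commute with evaluation up to the usual correction term. -/
theorem der_eval (d : Derivation R A A) (p : A[X]) (a : A) :
    d (p.eval a) = (coeffDer d p).eval a + (derivative p).eval a * d a := by
  -- Composition with the constant polynomial `C a` is evaluation at `a`.
  have h := congrArg (Polynomial.eval 0) (coeffDer_comp d p (C a))
  simpa [eval_comp, ← C_eq_algebraMap] using h

end CoeffDer

/-! ### Extending derivations to the fraction field -/

section Frac

variable {K A : Type*} [CommRing K] [CommRing A] [Algebra K A] (F : Type*) [Field F] [Algebra A F]

/-- The ring homomorphism `a ↦ a + d a ε` into the dual numbers of the fraction field. -/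
def dualHom (d : Derivation K A A) : A →+* TrivSqZeroExt F F where
  toFun a := TrivSqZeroExt.inl (algebraMap A F a) + TrivSqZeroExt.inr (algebraMap A F (d a))
  map_one' := by ext <;> simp
  map_mul' a b := by
    ext
    · simp
    · simp
      simp [Algebra.smul_def, mul_comm]
  map_zero' := by ext <;> simp
  map_add' a b := by ext <;> simp [Algebra.smul_def]

variable [IsFractionRing A F]

theorem isUnit_dualHom (d : Derivation K A A) (s : nonZeroDivisors A) :
    IsUnit (dualHom F d s) := by
  rw [TrivSqZeroExt.isUnit_iff_isUnit_fst]
  simpa [dualHom] using IsLocalization.map_units F s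

/-- The extension of a derivation to the dual numbers of the fraction field. -/
def fracDualHom (d : Derivation K A A) : F →+* TrivSqZeroExt F F :=
  IsLocalization.lift (M := nonZeroDivisors A) (isUnit_dualHom F d)

theorem fracDualHom_algebraMap (d : Derivation K A A) (a : A) :
    fracDualHom F d (algebraMap A F a) =
      TrivSqZeroExt.inl (algebraMap A F a) + TrivSqZeroExt.inr (algebraMap A F (d a)) :=
  IsLocalization.lift_eq _ _

theorem fst_fracDualHom (d : Derivation K A A) (x : F) : (fracDualHom F d x).fst = x := by
  have : (TrivSqZeroExt.fstHom F F F).toRingHom.comp (fracDualHom F d) = RingHom.id F := by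
    apply IsLocalization.ringHom_ext (nonZeroDivisors A)
    ext a
    simp [fracDualHom_algebraMap]
  exact congrArg (fun f => f x) this

/-- The extension of a derivation to the fraction field. -/
def fracDer (d : Derivation K A A) : Derivation ℤ F F :=
  Derivation.mk' (AddMonoidHom.toIntLinearMap
    { toFun := fun x => (fracDualHom F d x).snd
      map_zero' := by simp
      map_add' := by simp }) (by
    intro a b
    simp [fst_fracDualHom, mul_comm])

@[simp]
theorem fracDer_algebraMap (d : Derivation K A A) (a : A) :
    fracDer F d (algebraMap A F a) = algebraMap A F (d a) := by
  change (fracDualHom F d (algebraMap A F a)).snd = _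
  rw [fracDualHom_algebraMap, TrivSqZeroExt.snd_add, TrivSqZeroExt.snd_inl,
    TrivSqZeroExt.snd_inr, zero_add]

theorem der_frac_eq_zero {D : Derivation ℤ F F} (h : ∀ a, D (algebraMap A F a) = 0) : D = 0 := by
  ext x
  obtain ⟨a, s, hs, rfl⟩ := IsFractionRing.div_surjective (A := A) x
  simp [Derivation.leibniz_div, h]

theorem fracDer_comm {d e : Derivation K A A} (h : ∀ a, d (e a) = e (d a)) (x : F) :
    fracDer F d (fracDer F e x) = fracDer F e (fracDer F d x) := by
  have : ⁅fracDer F d, fracDer F e⁆ = 0 :=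
    der_frac_eq_zero (A := A) F fun a => by simp [Derivation.commutator_apply, h]
  have h2 := congrArg (fun D => D x) this
  simpa [Derivation.commutator_apply, sub_eq_zero] using h2

end Frac

end

/-! ### Constants of a derivation and algebraicity over `K` -/

section

open Polynomial in
-- An element of derivative `1` is transcendental over the constants of `D`: applying `D` to `P(y) =
-- 0` gives `P'(y) = 0`, and the degree drops.
theorem eq_zero_of_eval_eq_zero {F : Type*} [Field F] [CharZero F] (D : Derivation ℤ F F) {y : F}
    (hy : D y = 1) : ∀ (n : ℕ) (P : F[X]), P.natDegree ≤ n → coeffDer D P = 0 → P.eval y = 0 →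
    P = 0 := by
  intro n
  induction n with
  | zero =>
    intro P hn _ he
    rw [eq_C_of_natDegree_le_zero hn] at he ⊢
    simpa using he
  | succ n ih =>
    intro P hn hD he
    have h1 : P.derivative.eval y = 0 := by
      have := der_eval D P y
      simpa [he, hD, hy] using this.symm
    have h2 : coeffDer D P.derivative = 0 := by
      ext i
      have := congrArg (fun Q => Q.coeff (i + 1)) hD
      simp only [coeff_coeffDer, coeff_zero] at this
      simp only [coeff_coeffDer, coeff_derivative, Derivation.leibniz, this, smul_zero, add_zero,
        coeff_zero]
      simp
    have h3 : P.derivative = 0 := ih _ (by have := natDegree_derivative_le P; omega) h2 h1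
    rw [eq_C_of_natDegree_eq_zero (derivative_eq_zero.1 h3)] at he ⊢
    simpa using he

theorem mem_range_of_aeval_eq_zero {K F : Type*} [Field K] [IsAlgClosed K] [Field F] [Algebra K F]
    {σ : F} {q : Polynomial K} (hq : q ≠ 0) (h : Polynomial.aeval σ q = 0) :
    ∃ s : K, algebraMap K F s = σ := by
  have hint : IsIntegral K σ := (show IsAlgebraic K σ from ⟨q, hq, h⟩).isIntegral
  exact minpoly.mem_range_of_degree_eq_one K σ
    (IsAlgClosed.degree_eq_one_of_irreducible K (minpoly.irreducible hint))

open MvPolynomial in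
theorem coeff_pow_mul_X_pow {F : Type*} [CommRing F] {p : Polynomial F} {k : ℕ}
    (hp : p.natDegree ≤ k) {a b n : ℕ} (h : a * k + b ≤ n) :
    (p ^ a * Polynomial.X ^ b).coeff n = if a * k + b = n then p.coeff k ^ a else 0 := by
  rw [Polynomial.coeff_mul_X_pow', if_pos (by omega)]
  split_ifs with h1
  · rw [← h1, Nat.add_sub_cancel, Polynomial.coeff_pow_of_natDegree_le hp]
  · apply Polynomial.coeff_eq_zero_of_natDegree_lt
    have := Polynomial.natDegree_pow_le_of_le a hp
    omega

open MvPolynomial in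
-- Give `x` weight `k` and `y` weight `1`. The part of `f` of top weight `n` determines the
-- coefficient of `t ^ n` in `f(p(t), t)`, and this is a polynomial over `K` in the coefficient of
-- `t ^ k` in `p`. It vanishes because `n > 0`, so that coefficient is algebraic over `K`.
theorem coeff_mem_range {K F : Type*} [Field K] [IsAlgClosed K] [Field F] [Algebra K F]
    {f : MvPolynomial (Fin 2) K} (hf : ∀ c, f ≠ C c) {p : Polynomial F} {k : ℕ} (hk : 1 ≤ k)
    (hp : p.natDegree ≤ k) {c : F}
    (h : aeval ![p, Polynomial.X] f = Polynomial.C c) : ∃ s : K, algebraMap K F s = p.coeff k := by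
  classical
  set n := f.support.sup fun m => m 0 * k + m 1 with hn
  have hle : ∀ m ∈ f.support, m 0 * k + m 1 ≤ n := fun m hm =>
    Finset.le_sup (f := fun m : Fin 2 →₀ ℕ => m 0 * k + m 1) hm
  have hne : f.support.Nonempty := by
    rw [Finset.nonempty_iff_ne_empty, Ne, support_eq_empty]
    rintro rfl
    exact hf 0 (by simp)
  obtain ⟨m₀, hm₀, hmn⟩ := Finset.exists_mem_eq_sup _ hne fun m => m 0 * k + m 1
  have hn1 : n ≠ 0 := by
    intro h0
    apply hf (coeff 0 f)
    ext m
    rw [coeff_C]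
    split_ifs with hm
    · rw [hm]
    · by_contra hne
      have h1 := hle m (mem_support_iff.2 hne)
      have h2 : m 0 = 0 := by
        by_contra h3
        have := Nat.mul_pos (Nat.pos_of_ne_zero h3) hk
        omega
      refine hm (Finsupp.ext fun i => ?_)
      fin_cases i
      · exact h2.symm
      · change 0 = m 1
        omega
  -- The polynomial is nonzero: monomials of equal weight are separated by their exponent of `x`, so
  -- nothing cancels.
  refine mem_range_of_aeval_eq_zero
    (q := ∑ m ∈ f.support with m 0 * k + m 1 = n, Polynomial.monomial (m 0) (coeff m f)) ?_ ?_
  · intro h0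
    have h1 := congrArg (fun q => q.coeff (m₀ 0)) h0
    simp only [Polynomial.finsetSum_coeff, Polynomial.coeff_monomial, Polynomial.coeff_zero] at h1
    rw [Finset.sum_eq_single m₀] at h1
    · rw [if_pos rfl] at h1
      exact mem_support_iff.1 hm₀ h1
    · intro m hm hne
      rw [if_neg]
      intro h2
      rw [Finset.mem_filter] at hm
      refine hne (Finsupp.ext fun i => ?_)
      fin_cases i
      · exact h2
      · change m 1 = m₀ 1
        rw [h2] at hm
        have := hm.2
        omega
    · intro hm
      exact absurd (Finset.mem_filter.2 ⟨hm₀, hmn.symm⟩) hm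
  · have h1 := congrArg (fun q => q.coeff n) h
    simp only [Polynomial.coeff_C, if_neg hn1] at h1
    rw [aeval_def, eval₂_eq', Polynomial.finsetSum_coeff] at h1
    rw [map_sum, ← h1, Finset.sum_filter]
    refine Finset.sum_congr rfl fun m hm => ?_
    rw [Fin.prod_univ_two]
    simp only [Matrix.cons_val_zero, Matrix.cons_val_one, Polynomial.aeval_monomial,
      IsScalarTower.algebraMap_apply K F (Polynomial F), Polynomial.algebraMap_eq,
      Polynomial.coeff_C_mul, coeff_pow_mul_X_pow hp (hle m hm)]
    split_ifs <;> simp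

open MvPolynomial in
/-- A derivation killing the constants acts on polynomial expressions by the chain rule. -/
theorem der_aeval {K B R : Type*} [CommRing K] [CommRing B] [Algebra K B] [CommRing R]
    [Algebra R B] (D : Derivation R B B) (hD : ∀ c : K, D (algebraMap K B c) = 0) (g : Fin 2 → B)
    (f : MvPolynomial (Fin 2) K) :
    D (aeval g f) = aeval g (pderiv 0 f) * D (g 0) + aeval g (pderiv 1 f) * D (g 1) := by
  induction f using MvPolynomial.induction_on with
  | C a => simp [hD, algHom_C]
  | add p q hp hq => simp only [map_add, hp, hq]; ring
  | mul_X p i hp =>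
    fin_cases i <;> simp [Derivation.leibniz, hp, pderiv_X] <;> ring

end

/-! ### Plane curves whose level sets are parabolas -/

section

open MvPolynomial

variable {K : Type*} [Field K]

/-- The substitution `x ↦ x + S y² + L y`, `y ↦ y`. -/
def parabolicShear (S L : K) : MvPolynomial (Fin 2) K →ₐ[K] MvPolynomial (Fin 2) K :=
  aeval ![X 0 + C S * X 1 ^ 2 + C L * X 1, X 1]

theorem parabolicShear_neg (S L : K) (f : MvPolynomial (Fin 2) K) :
    parabolicShear (-S) (-L) (parabolicShear S L f) = f := by
  have : (parabolicShear (-S) (-L)).comp (parabolicShear S L) = AlgHom.id K _ := by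
    apply MvPolynomial.algHom_ext
    intro i
    fin_cases i <;> simp [parabolicShear]
    ring
  exact DFunLike.congr_fun this f

theorem parabolicShear_ne_C {S L : K} {f : MvPolynomial (Fin 2) K} (hf : ∀ c, f ≠ C c) (c : K) :
    parabolicShear S L f ≠ C c := by
  intro h
  apply hf c
  rw [← parabolicShear_neg S L f, h]
  simp [parabolicShear]

theorem aeval_parabolicShear {B : Type*} [CommRing B] [Algebra K B] (S L : K) (p q : B)
    (f : MvPolynomial (Fin 2) K) : aeval ![p, q] (parabolicShear S L f) =
      aeval ![p + algebraMap K B S * q ^ 2 + algebraMap K B L * q, q] f := by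
  have : (aeval ![p, q]).comp (parabolicShear S L) =
      aeval ![p + algebraMap K B S * q ^ 2 + algebraMap K B L * q, q] := by
    apply MvPolynomial.algHom_ext
    intro i
    fin_cases i <;> simp [parabolicShear, algHom_C]
  exact DFunLike.congr_fun this f

variable [CharZero K]

theorem exists_eq_aeval_X_zero {f : MvPolynomial (Fin 2) K} (h : pderiv 1 f = 0) :
    ∃ G : Polynomial K, f = Polynomial.aeval (X 0) G := by
  classical
  refine ⟨∑ m ∈ f.support, Polynomial.monomial (m 0) (coeff m f), ?_⟩
  rw [pderiv_eq_zero_iff_degreeOf, ← Nat.le_zero, degreeOf_le_iff] at h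
  conv_lhs => rw [f.as_sum]
  rw [map_sum]
  refine Finset.sum_congr rfl fun m hm => ?_
  rw [Polynomial.aeval_monomial, monomial_eq, Finsupp.prod_fintype _ _ (by simp),
    Fin.prod_univ_two, Nat.le_zero.1 (h m hm)]
  simp

/-- The parabolic shear straightens the level curves to lines `x = const`, after which `f` no longer
involves `y`. -/
theorem exists_eq_aeval_parabola {f : MvPolynomial (Fin 2) K} {S L : K}
    (h : pderiv 1 f = -(C (2 * S) * X 1 + C L) * pderiv 0 f) :
    ∃ G : Polynomial K, f = Polynomial.aeval (X 0 - C S * X 1 ^ 2 - C L * X 1) G := by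
  have h1 : pderiv 1 (parabolicShear S L f) = 0 := by
    have hy : parabolicShear S L (X 1) = X 1 := by simp [parabolicShear]
    have hc : ∀ c, parabolicShear S L (C c) = C c := fun c => by simp [parabolicShear]
    have := der_aeval (pderiv (R := K) (1 : Fin 2)) (by simp [algebraMap_eq])
      ![X 0 + C S * X 1 ^ 2 + C L * X 1, X 1] f
    change pderiv 1 (parabolicShear S L f) = parabolicShear S L (pderiv 0 f) * _ +
      parabolicShear S L (pderiv 1 f) * _ at this
    rw [this, h]
    simp only [map_mul, map_neg, map_add, hy, hc, Matrix.cons_val_zero, Matrix.cons_val_one,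
      Derivation.leibniz, Derivation.leibniz_pow, pderiv_X_self, pderiv_C, map_ofNat]
    rw [pderiv_X_of_ne (by decide)]
    simp
    ring
  obtain ⟨G, hG⟩ := exists_eq_aeval_X_zero h1
  refine ⟨G, ?_⟩
  rw [← parabolicShear_neg S L f, hG, ← Polynomial.aeval_algHom_apply]
  have : parabolicShear (-S) (-L) (X 0) = X 0 - C S * X 1 ^ 2 - C L * X 1 := by
    simp [parabolicShear]
    ring
  rw [this]

variable [IsAlgClosed K]

/-- If the level curves of `f` have slope `σ = -f_y / f_x` whose derivative along the level curves
is constant along the level curves, then they are translates of one parabola. -/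
theorem slope_eq_of_constant_curvature {F : Type*} [Field F] [Algebra (MvPolynomial (Fin 2) K) F]
    [IsFractionRing (MvPolynomial (Fin 2) K) F] [Algebra K F]
    [IsScalarTower K (MvPolynomial (Fin 2) K) F]
    {f : MvPolynomial (Fin 2) K} (hf : ∀ c, f ≠ C c) {σ : F} {D : Derivation ℤ F F}
    (hD : D = fracDer F (pderiv (R := K) (1 : Fin 2)) + σ • fracDer F (pderiv (R := K) (0 : Fin 2)))
    (hσ : D (algebraMap _ F f) = 0) (hcurv : D (D σ) = 0) :
    ∃ S L : K, pderiv 1 f = -(C (2 * S) * X 1 + C L) * pderiv 0 f := by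
  have : CharZero F := charZero_of_injective_algebraMap (algebraMap K F).injective
  set ι := algebraMap (MvPolynomial (Fin 2) K) F with hι
  have hinj : Function.Injective ι := IsFractionRing.injective _ _
  have hDι (g) : D (ι g) = ι (pderiv 1 g) + σ * ι (pderiv 0 g) := by
    rw [hD, Derivation.add_apply, Derivation.smul_apply, hι, fracDer_algebraMap,
      fracDer_algebraMap, smul_eq_mul]
  have hx : D (ι (X 0)) = σ := by
    rw [hDι, pderiv_X_of_ne (by decide), pderiv_X_self]; simp
  have hy : D (ι (X 1)) = 1 := by
    rw [hDι, pderiv_X_self, pderiv_X_of_ne (by decide)]; simp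
  have hDtwo : D (2 : F) = 0 := by exact_mod_cast D.map_natCast 2
  have hD2 : D (2⁻¹ : F) = 0 := by rw [D.leibniz_inv, hDtwo, smul_zero]
  have hDK (c : K) : D (algebraMap K F c) = 0 := by
    rw [IsScalarTower.algebraMap_apply K (MvPolynomial (Fin 2) K) F, hDι]
    simp [algebraMap_eq]
  -- These solve `σ = 2 s y + l` and `x = s y² + l y + n`; all three are constant along the level
  -- curves.
  obtain ⟨s, hs⟩ : ∃ s, s = 2⁻¹ * D σ := ⟨_, rfl⟩
  obtain ⟨l, hl⟩ : ∃ l, l = σ - 2 * s * ι (X 1) := ⟨_, rfl⟩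
  obtain ⟨n, hn⟩ : ∃ n, n = ι (X 0) - s * ι (X 1) ^ 2 - l * ι (X 1) := ⟨_, rfl⟩
  have hDs : D s = 0 := by rw [hs]; simp [hD2, hcurv]
  have h2s : D σ = 2 * s := by rw [hs]; field_simp
  have hDl : D l = 0 := by
    rw [hl]; simp [hDs, hy, h2s, hDtwo]
  have hDn : D n = 0 := by
    rw [hn]; simp [hDs, hDl, hx, hy]; rw [hl]; ring
  obtain ⟨p, hp⟩ : ∃ p : Polynomial F, p = Polynomial.C s * Polynomial.X ^ 2 +
      Polynomial.C l * Polynomial.X + Polynomial.C n := ⟨_, rfl⟩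
  have hpD : coeffDer D p = 0 := by
    rw [hp]; simp [hDs, hDl, hDn]
  -- The difference of the two sides has coefficients killed by `D` and vanishes at `t = y`, where
  -- `p` takes the value `x`.
  have hpf : aeval ![p, Polynomial.X] f = Polynomial.C (ι f) := by
    rw [← sub_eq_zero]
    refine eq_zero_of_eval_eq_zero D hy _ _ le_rfl ?_ ?_
    · rw [map_sub, der_aeval (coeffDer D) (by
        intro c
        rw [IsScalarTower.algebraMap_apply K F (Polynomial F)]
        simp [Polynomial.algebraMap_eq, hDK])]
      simp [hpD, hσ]
    · have : ((Polynomial.aeval (ι (X 1))).restrictScalars K).comp (aeval ![p, Polynomial.X]) =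
          IsScalarTower.toAlgHom K (MvPolynomial (Fin 2) K) F := by
        apply MvPolynomial.algHom_ext
        intro i
        fin_cases i
        · simp [hp, hn]; rfl
        · simp; rfl
      have := DFunLike.congr_fun this f
      simp only [AlgHom.comp_apply, AlgHom.restrictScalars_apply, Polynomial.coe_aeval_eq_eval,
        IsScalarTower.coe_toAlgHom'] at this
      rw [Polynomial.eval_sub, this, Polynomial.eval_C, sub_self]
  obtain ⟨S, hS⟩ := coeff_mem_range hf (k := 2) (by norm_num)
    (by rw [hp]; exact Polynomial.natDegree_quadratic_le) hpf
  have hS' : algebraMap K F S = s := by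
    rw [hS, hp]; simp
  -- With `S y²` absorbed into `f`, the remaining curve is linear in `t`, and weight `1` picks out
  -- `l`.
  obtain ⟨L, hL⟩ := coeff_mem_range (F := F) (parabolicShear_ne_C (S := S) (L := 0) hf) (k := 1)
    le_rfl (p := Polynomial.C l * Polynomial.X + Polynomial.C n) Polynomial.natDegree_linear_le
    (c := ι f) (by
      rw [aeval_parabolicShear, ← hpf, hp]
      congr 3
      rw [IsScalarTower.algebraMap_apply K F (Polynomial F), hS']
      simp [Polynomial.algebraMap_eq]
      ring)
  have hL' : algebraMap K F L = l := by
    rw [hL]; simp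
  refine ⟨S, L, hinj ?_⟩
  have h1 := hDι f
  rw [hσ] at h1
  have h2 : σ = ι (C (2 * S) * X 1 + C L) := by
    have h3 (c : K) : ι (C c) = algebraMap K F c :=
      (IsScalarTower.algebraMap_apply K (MvPolynomial (Fin 2) K) F c).symm
    rw [map_add, map_mul, h3, h3, map_mul, hS', hL', hl, map_ofNat]
    ring
  rw [map_mul, map_neg, ← h2]
  linear_combination -h1

end

/-! ### Slopes of level curves, planar nilpotent pairs, and integration -/

section

section Commuting

variable {F : Type*} [Field F] {D E : Derivation ℤ F F}

/-- The hypotheses say that `v` and `a` are constant along curves of slope `σ`. Then `D a / D v`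
plays the role of `da/dv`, again constant along them; formally, compare `D (E a)` with `E (D a)`. -/
theorem slope_div (hDE : ∀ a, D (E a) = E (D a)) {v a σ : F} (hv : D v ≠ 0) (hσv : E v = -σ * D v)
    (hσa : E a = -σ * D a) : E (D a / D v) = -σ * D (D a / D v) := by
  obtain ⟨r, hr⟩ : ∃ r, r = D a / D v := ⟨_, rfl⟩
  have h1 : D a = r * D v := by rw [hr, div_mul_cancel₀ _ hv]
  have h2 : E a = r * E v := by rw [hσa, h1, hσv]; ring
  have h3 := hDE a
  rw [h2, h1, Derivation.leibniz, Derivation.leibniz, hDE v] at h3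
  simp only [smul_eq_mul] at h3
  rw [← hr]
  have h4 : (E r + σ * D r) * D v = 0 := by linear_combination -h3 + D r * hσv
  have := (mul_eq_zero.1 h4).resolve_right hv
  linear_combination this

end Commuting

open MvPolynomial

variable {K : Type*} [Field K] [CharZero K] [IsAlgClosed K]

/-- The second hypothesis is `D σ = 0` with denominators cleared: the level curves are straight. -/
theorem slope_eq_of_curvature_eq_zero (F : Type*) [Field F] [Algebra (MvPolynomial (Fin 2) K) F]
    [IsFractionRing (MvPolynomial (Fin 2) K) F] [Algebra K F]
    [IsScalarTower K (MvPolynomial (Fin 2) K) F] {f : MvPolynomial (Fin 2) K}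
    (hfx : pderiv 0 f ≠ 0)
    (hcurv : pderiv 1 (pderiv 1 f) * pderiv 0 f ^ 2
      - 2 * pderiv 0 f * pderiv 1 f * pderiv 0 (pderiv 1 f)
      + pderiv 1 f ^ 2 * pderiv 0 (pderiv 0 f) = 0) :
    ∃ S L : K, pderiv 1 f = -(C (2 * S) * X 1 + C L) * pderiv 0 f := by
  set ι := algebraMap (MvPolynomial (Fin 2) K) F with hι
  have hinj : Function.Injective ι := IsFractionRing.injective _ _
  have hx0 : ι (pderiv 0 f) ≠ 0 := fun h => hfx (hinj (by rw [h, map_zero]))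
  have hfc : ∀ c, f ≠ C c := by
    rintro c rfl
    simp at hfx
  have hDσ : (fracDer F (pderiv (R := K) (1 : Fin 2)) + (-ι (pderiv 1 f) / ι (pderiv 0 f)) •
      fracDer F (pderiv (R := K) (0 : Fin 2))) (-ι (pderiv 1 f) / ι (pderiv 0 f)) = 0 := by
    have h := congrArg ι hcurv
    simp only [map_add, map_sub, map_mul, map_pow, map_ofNat, map_zero] at h
    simp only [Derivation.add_apply, Derivation.smul_apply, Derivation.leibniz_div, map_neg, hι,
      fracDer_algebraMap, smul_eq_mul]
    simp only [hι] at h hx0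
    rw [pderiv_comm (i := 1) (j := 0) f]
    field_simp
    linear_combination -h
  exact slope_eq_of_constant_curvature (F := F) hfc
    (σ := -ι (pderiv 1 f) / ι (pderiv 0 f)) rfl (by
    simp only [Derivation.add_apply, Derivation.smul_apply, hι, fracDer_algebraMap, smul_eq_mul]
    simp only [hι] at hx0
    field_simp
    ring) (by rw [hDσ, map_zero])

/-- The two-dimensional case: the level curves of `f` are straight and, with slope in `K`, parallel.
Then `f - L g` is constant. -/
theorem planar_dependent {f g : MvPolynomial (Fin 2) K} (htr : pderiv 0 f + pderiv 1 g = 0)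
    (hdet : pderiv 0 f * pderiv 1 g = pderiv 1 f * pderiv 0 g) :
    ∃ α β c : K, (α ≠ 0 ∨ β ≠ 0) ∧ C α * f + C β * g = C c := by
  by_cases hfx : pderiv 0 f = 0
  · rw [hfx, zero_add] at htr
    rw [hfx, zero_mul, eq_comm, mul_eq_zero] at hdet
    rcases hdet with h | h
    · obtain ⟨c, hc⟩ := eq_C_of_pderiv_eq_zero hfx h
      exact ⟨1, 0, c, by simp, by simp [hc]⟩
    · obtain ⟨c, hc⟩ := eq_C_of_pderiv_eq_zero h htr
      exact ⟨0, 1, c, by simp, by simp [hc]⟩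
  have hgy : pderiv 1 g = -pderiv 0 f := by linear_combination htr
  -- Differentiate the determinant equation in `y`, multiply by `f_y`, and replace `f_y g_x` by
  -- `-f_x²`.
  have hcurv : pderiv 1 (pderiv 1 f) * pderiv 0 f ^ 2
      - 2 * pderiv 0 f * pderiv 1 f * pderiv 0 (pderiv 1 f)
      + pderiv 1 f ^ 2 * pderiv 0 (pderiv 0 f) = 0 := by
    have h1 := congrArg (pderiv 1) hdet
    rw [hgy] at h1 hdet
    simp only [Derivation.leibniz, map_neg, smul_eq_mul] at h1
    rw [pderiv_comm (i := 1) (j := 0) f, pderiv_comm (i := 1) (j := 0) g, hgy, map_neg] at h1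
    linear_combination (pderiv 1 f) * h1 - (pderiv 1 (pderiv 1 f)) * hdet
  obtain ⟨S, L, hSL⟩ := slope_eq_of_curvature_eq_zero (FractionRing (MvPolynomial (Fin 2) K)) hfx hcurv
  -- Inserting the slope into the curvature equation leaves only `2 S f_x³`, up to sign.
  have hS : S = 0 := by
    have h1 := congrArg (pderiv 0) hSL
    have h2 := congrArg (pderiv 1) hSL
    simp only [Derivation.leibniz, map_neg, map_add, pderiv_X_self, pderiv_C, smul_eq_mul] at h1 h2
    rw [pderiv_X_of_ne (by decide)] at h1
    rw [pderiv_comm (i := 1) (j := 0) f] at h2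
    rw [h2, h1, hSL] at hcurv
    have h3 : C (2 * S) * pderiv 0 f ^ 3 = 0 := by linear_combination -hcurv
    have h4 := (mul_eq_zero.1 h3).resolve_right (pow_ne_zero _ hfx)
    simpa using h4
  rw [hS] at hSL
  have hfy : pderiv 1 f = - C L * pderiv 0 f := by rw [hSL]; simp
  have hfx' : pderiv 0 f = C L * pderiv 0 g := by
    have : pderiv 0 f * (pderiv 0 f - C L * pderiv 0 g) = 0 := by
      rw [hgy, hfy] at hdet
      linear_combination -hdet
    exact sub_eq_zero.1 ((mul_eq_zero.1 this).resolve_left hfx)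
  obtain ⟨c, hc⟩ := eq_C_of_pderiv_eq_zero (f := f - C L * g)
    (by simp [Derivation.leibniz, hfx']) (by simp [Derivation.leibniz, hgy, hfy])
  exact ⟨1, -L, c, by simp, by rw [← hc]; simp; ring⟩

theorem exists_parabola (F : Type*) [Field F] [Algebra (MvPolynomial (Fin 2) K) F]
    [IsFractionRing (MvPolynomial (Fin 2) K) F] [Algebra K F]
    [IsScalarTower K (MvPolynomial (Fin 2) K) F] {v h φ : MvPolynomial (Fin 2) K} {k : K} (hvx : pderiv 0 v ≠ 0)
    (hvh : pderiv 0 v * pderiv 1 h = pderiv 1 v * pderiv 0 h) (hφx : pderiv 0 φ = -pderiv 1 v)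
    (hφy : pderiv 1 φ * pderiv 0 v + C k * pderiv 0 h = -pderiv 1 v ^ 2) :
    ∃ S L : K, pderiv 1 v = -(C (2 * S) * X 1 + C L) * pderiv 0 v := by
  set ι := algebraMap (MvPolynomial (Fin 2) K) F with hι
  have hinj : Function.Injective ι := IsFractionRing.injective _ _
  have hx0 : ι (pderiv 0 v) ≠ 0 := fun h => hvx (hinj (by rw [h, map_zero]))
  have hvc : ∀ c, v ≠ C c := by
    rintro c rfl
    simp at hvx
  obtain ⟨D, hD⟩ : ∃ D, D = fracDer F (pderiv (R := K) (0 : Fin 2)) := ⟨_, rfl⟩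
  obtain ⟨E, hE⟩ : ∃ E, E = fracDer F (pderiv (R := K) (1 : Fin 2)) := ⟨_, rfl⟩
  have hDι (g) : D (ι g) = ι (pderiv 0 g) := by rw [hD]; exact fracDer_algebraMap _ _ _
  have hEι (g) : E (ι g) = ι (pderiv 1 g) := by rw [hE]; exact fracDer_algebraMap _ _ _
  have hDE (a : F) : D (E a) = E (D a) := by
    rw [hD, hE]; exact fracDer_comm F (fun a => pderiv_comm a) a
  obtain ⟨σ, hσ⟩ : ∃ σ, σ = -ι (pderiv 1 v) / ι (pderiv 0 v) := ⟨_, rfl⟩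
  have hEv : E (ι v) = -σ * D (ι v) := by
    rw [hEι, hDι, hσ]; field_simp
  have hEh : E (ι h) = -σ * D (ι h) := by
    have := congrArg ι hvh
    rw [map_mul, map_mul] at this
    rw [hEι, hDι, hσ]; field_simp
    linear_combination this
  have hDv : D (ι v) ≠ 0 := by rwa [hDι]
  obtain ⟨R, hR⟩ : ∃ R, R = D (ι h) / D (ι v) := ⟨_, rfl⟩
  have hER : E R = -σ * D R := by rw [hR]; exact slope_div hDE hDv hEv hEh
  have hER' : E (D R / D (ι v)) = -σ * D (D R / D (ι v)) := slope_div hDE hDv hEv hER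
  have hDk : D (ι (C k)) = 0 := by rw [hDι]; simp
  have hEk : E (ι (C k)) = 0 := by rw [hEι]; simp
  have hDφ : D (ι φ) = σ * D (ι v) := by
    rw [hDι, hφx, map_neg, ← hEι, hEv]; ring
  have hEφ : E (ι φ) = -ι (C k) * R - σ ^ 2 * D (ι v) := by
    have := congrArg ι hφy
    simp only [map_add, map_mul, map_neg, map_pow] at this
    rw [← hEι, ← hEι, ← hDι, ← hDι, hEv] at this
    rw [hR]
    field_simp
    linear_combination this
  -- This is `φ_xy = φ_yx`, with the second derivatives of `v` eliminated by `v_y = -σ v_x`.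
  have hcurv : E σ + σ * D σ = -ι (C k) * (D R / D (ι v)) := by
    have h1 := hDE (ι φ)
    rw [hDφ, hEφ] at h1
    have h2 := hDE (ι v)
    rw [hEv] at h2
    simp only [map_sub, map_neg, Derivation.leibniz, Derivation.leibniz_pow, smul_eq_mul, hDk,
      nsmul_eq_mul, ← h2] at h1
    field_simp
    push_cast at h1
    linear_combination -h1
  refine slope_eq_of_constant_curvature (F := F) hvc (σ := σ) (D := E + σ • D) (by rw [hD, hE]) ?_ ?_
  · change E (ι v) + σ * D (ι v) = 0
    rw [hEv]; ring
  · change E (E σ + σ * D σ) + σ * D (E σ + σ * D σ) = 0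
    rw [hcurv]
    simp only [map_neg, Derivation.leibniz, smul_eq_mul, hDk, hEk, hER', neg_mul]
    ring

/-- Normal form when the second component does not involve the first. -/
theorem exists_normal_data {v h φ : MvPolynomial (Fin 2) K} {k : K} (hk : k ≠ 0)
    (hvx : pderiv 0 v ≠ 0)
    (hvh : pderiv 0 v * pderiv 1 h = pderiv 1 v * pderiv 0 h) (hφx : pderiv 0 φ = -pderiv 1 v)
    (hφy : pderiv 1 φ * pderiv 0 v + C k * pderiv 0 h = -pderiv 1 v ^ 2) :
    ∃ (S L l e₁ e₂ : K) (G : Polynomial K),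
      v = Polynomial.aeval (X 0 - C S * X 1 ^ 2 - C L * X 1) G ∧
      φ = (C (2 * S) * X 1 + C L) * v - C (k * l) * X 1 + C e₁ ∧
      h = C (-S / k) * v ^ 2 + C l * v + C e₂ := by
  obtain ⟨S, L, hSL⟩ := exists_parabola (FractionRing (MvPolynomial (Fin 2) K)) hvx hvh hφx hφy
  obtain ⟨G, hG⟩ := exists_eq_aeval_parabola hSL
  obtain ⟨m, hm⟩ : ∃ m : MvPolynomial (Fin 2) K, m = C (2 * S) * X 1 + C L := ⟨_, rfl⟩
  have hmx : pderiv 0 m = 0 := by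
    rw [hm]; simp [Derivation.leibniz]
  have hmy : pderiv 1 m = C (2 * S) := by
    rw [hm]; simp [Derivation.leibniz]
  rw [← hm] at hSL
  have hhy : pderiv 1 h = -m * pderiv 0 h := by
    apply mul_left_cancel₀ hvx
    rw [hvh, hSL]; ring
  -- Since `φ_x = -v_y = m v_x` and `m` is free of `x`, subtracting `m v` leaves a function of `y`
  -- alone.
  obtain ⟨ψ, hψ⟩ : ∃ ψ, ψ = φ - m * v := ⟨_, rfl⟩
  have hψx : pderiv 0 ψ = 0 := by
    rw [hψ]; simp [Derivation.leibniz, hmx, hφx, hSL]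
  have hψy : pderiv 1 ψ * pderiv 0 v = -C k * pderiv 0 h - C (2 * S) * v * pderiv 0 v := by
    rw [hψ]
    simp only [map_sub, Derivation.leibniz, smul_eq_mul, hmy]
    rw [hSL] at hφy ⊢
    linear_combination hφy
  -- Apply `∂_y + m ∂_x` to the previous equation: it commutes with `∂_x` and kills `v` and `h`.
  have hψyy : pderiv 1 (pderiv 1 ψ) = 0 := by
    have h1 := congrArg (pderiv 1) hψy
    have h2 := congrArg (pderiv 0) hψy
    have h3 := congrArg (pderiv 0) hSL
    have h4 := congrArg (pderiv 0) hhy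
    simp only [map_sub, map_neg, Derivation.leibniz, smul_eq_mul, pderiv_C, hmx] at h1 h2 h3 h4
    rw [pderiv_comm (i := 1) (j := 0) v, pderiv_comm (i := 1) (j := 0) h, h3, h4, hSL] at h1
    rw [pderiv_comm (i := 0) (j := 1) ψ, hψx, map_zero] at h2
    have h5 : pderiv 1 (pderiv 1 ψ) * pderiv 0 v = 0 := by linear_combination h1 + m * h2
    exact (mul_eq_zero.1 h5).resolve_right hvx
  obtain ⟨μ, hμ⟩ := eq_C_of_pderiv_eq_zero (f := pderiv 1 ψ)
    (by rw [pderiv_comm, hψx, map_zero]) hψyy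
  obtain ⟨e₁, he₁⟩ := eq_C_of_pderiv_eq_zero (f := ψ - C μ * X 1)
    (by simp [Derivation.leibniz, hψx]) (by simp [Derivation.leibniz, hμ])
  have hkC : C k * C k⁻¹ = (1 : MvPolynomial (Fin 2) K) := by
    rw [← C_mul, mul_inv_cancel₀ hk, C_1]
  have hhx : pderiv 0 h = C (-S / k) * (2 * v * pderiv 0 v) + C (-μ / k) * pderiv 0 v := by
    rw [hμ] at hψy
    simp only [div_eq_mul_inv, neg_mul, C_neg, C_mul] at hψy ⊢
    have h2 : (C 2 : MvPolynomial (Fin 2) K) = 2 := map_ofNat C 2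
    rw [h2] at hψy
    linear_combination (-pderiv 0 h) * hkC + C k⁻¹ * hψy
  obtain ⟨e₂, he₂⟩ := eq_C_of_pderiv_eq_zero (f := h - C (-S / k) * v ^ 2 - C (-μ / k) * v)
    (by
      simp only [map_sub, Derivation.leibniz, Derivation.leibniz_pow, smul_eq_mul, pderiv_C, hhx,
        nsmul_eq_mul]
      push_cast
      ring)
    (by
      simp only [map_sub, Derivation.leibniz, Derivation.leibniz_pow, smul_eq_mul, pderiv_C, hhy,
        hhx, hSL, nsmul_eq_mul]
      push_cast
      ring)
  refine ⟨S, L, -μ / k, e₁, e₂, G, hG, ?_, ?_⟩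
  · rw [← hm]
    have : k * (-μ / k) = -μ := by field_simp
    rw [this, C_neg]
    linear_combination he₁ - hψ
  · linear_combination he₂

end

/-! ### Degree bounds in the last variable -/

section

open Polynomial

theorem comp_left_cancel {A : Type*} [CommRing A] [IsDomain A] {u : A[X]} (hu : 1 ≤ u.natDegree)
    {f g : A[X]} (h : f.comp u = g.comp u) : f = g := by
  rw [← sub_eq_zero, ← sub_comp, comp_eq_zero_iff] at h
  rcases h with h | ⟨-, h⟩
  · exact sub_eq_zero.1 h
  · rw [h, natDegree_C] at hu
    omega

theorem natDegree_coeffDer_le {R A : Type*} [CommRing R] [CommRing A] [Algebra R A]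
    (d : Derivation R A A) (p : A[X]) : (coeffDer d p).natDegree ≤ p.natDegree := by
  rw [natDegree_le_iff_coeff_eq_zero]
  intro n hn
  rw [coeff_coeffDer, coeff_eq_zero_of_natDegree_lt hn, map_zero]

variable {K : Type*} [Field K]

/-- The derivative with respect to `x` of a polynomial with coefficients in `K[x, y]`. -/
abbrev dX : Derivation K (MvPolynomial (Fin 2) K)[X] (MvPolynomial (Fin 2) K)[X] :=
  coeffDer (MvPolynomial.pderiv 0)

/-- The derivative with respect to `y` of a polynomial with coefficients in `K[x, y]`. -/
abbrev dY : Derivation K (MvPolynomial (Fin 2) K)[X] (MvPolynomial (Fin 2) K)[X] :=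
  coeffDer (MvPolynomial.pderiv 1)

/-- The equations expressing that the trace and the sum of the principal minors of the Jacobian
matrix vanish, together with the reduced form of the vanishing of its determinant. -/
structure NilpotentEquations (u v : (MvPolynomial (Fin 2) K)[X]) (h : MvPolynomial (Fin 2) K) :
    Prop where
  trace : dX u + (dY v).comp u + (derivative v).comp u * dY u = 0
  minors : dX u * (dY v).comp u - dY u * (dX v).comp u =
    derivative u * (C (MvPolynomial.pderiv 0 h) + (derivative v).comp u *
      C (MvPolynomial.pderiv 1 h))
  det : dX v * C (MvPolynomial.pderiv 1 h) = dY v * C (MvPolynomial.pderiv 0 h)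

variable {u v : (MvPolynomial (Fin 2) K)[X]} {h : MvPolynomial (Fin 2) K} [CharZero K]

/-- In the trace equation `v_w(u)` has degree exactly `(m - 1) d` in `z`, while the terms without
`u_y` have at most that degree. Hence `u_y` has degree `0`. -/
theorem NilpotentEquations.dY_eq_C (H : NilpotentEquations u v h) (hu : 1 ≤ u.natDegree)
    (hv : 2 ≤ v.natDegree) : ∃ b, dY u = C b := by
  set d := u.natDegree with hd
  set m := v.natDegree with hm
  have hu0 : u ≠ 0 := by rintro rfl; simp at hd; omega
  have hv0 : v ≠ 0 := by rintro rfl; simp at hm; omega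
  have hmd : d < m * d := by nlinarith
  -- The coefficient of `z ^ (m d)` in `v(u)` is a multiple of the leading coefficient of `v`; as `d
  -- < m d`, `u_x` does not contribute there.
  have hlc : MvPolynomial.pderiv 1 v.leadingCoeff = 0 := by
    have h1 := H.trace
    rw [add_assoc, ← coeffDer_comp] at h1
    have h2 := congrArg (fun p => p.coeff (m * d)) h1
    simp only [coeff_add, coeff_coeffDer, coeff_zero] at h2
    rw [coeff_eq_zero_of_natDegree_lt hmd, map_zero, zero_add] at h2
    have h3 : (v.comp u).coeff (m * d) = v.leadingCoeff * u.leadingCoeff ^ m := by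
      rw [← leadingCoeff_comp (by omega), leadingCoeff, natDegree_comp]
    rw [h3] at h2
    exact pderiv_eq_zero_of_mul_left (leadingCoeff_ne_zero.2 hv0)
      (pow_ne_zero _ (leadingCoeff_ne_zero.2 hu0)) h2
  have hdYv : (dY v).natDegree ≤ m - 1 := by
    rw [natDegree_le_iff_coeff_eq_zero]
    intro n hn
    rw [coeff_coeffDer]
    rcases (show m ≤ n by omega).eq_or_lt with rfl | h1
    · exact hlc
    · rw [coeff_eq_zero_of_natDegree_lt h1, map_zero]
  refine ⟨_, eq_C_of_natDegree_eq_zero (p := dY u) ?_⟩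
  by_contra he
  have hdYu0 : dY u ≠ 0 := by intro h0; rw [h0] at he; simp at he
  have hv'0 : (derivative v).comp u ≠ 0 := by
    intro h0
    rw [← zero_comp (p := u)] at h0
    have := derivative_eq_zero.1 (comp_left_cancel hu h0)
    omega
  have h1 : (derivative v).comp u * dY u = -(dX u + (dY v).comp u) := by
    linear_combination H.trace
  have h2 := congrArg natDegree h1
  rw [natDegree_mul hv'0 hdYu0, natDegree_comp, natDegree_derivative, natDegree_neg] at h2
  have h3 : (dX u + (dY v).comp u).natDegree ≤ (m - 1) * d := by
    refine (natDegree_add_le _ _).trans (max_le ?_ ?_)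
    · exact (natDegree_coeffDer_le _ _).trans (Nat.le_mul_of_pos_left _ (by omega))
    · rw [natDegree_comp]
      exact Nat.mul_le_mul_right _ hdYv
  rw [← hm, ← hd] at h2
  omega

/-- With `u_y` free of `z`, the trace makes `u_x` a polynomial in `u`, and the minors equation
becomes `u_z P(u) = W(u)`. Degrees show that `d` divides `d - 1`. -/
theorem NilpotentEquations.natDegree_eq_one (H : NilpotentEquations u v h) (hu : 1 ≤ u.natDegree)
    (hv : 2 ≤ v.natDegree) (hh : ∀ c, h ≠ MvPolynomial.C c) : u.natDegree = 1 := by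
  obtain ⟨b, hb⟩ := H.dY_eq_C hu hv
  set P := C (MvPolynomial.pderiv 0 h) + derivative v * C (MvPolynomial.pderiv 1 h) with hP
  set W := -(dY v) ^ 2 - dY v * derivative v * C b - C b * dX v with hW
  have hv' : derivative v ≠ 0 := by
    intro h0
    have := derivative_eq_zero.1 h0
    omega
  have hP0 : P ≠ 0 := by
    intro h0
    have hy : MvPolynomial.pderiv 1 h = 0 := by
      have h1 := congrArg (fun p => p.coeff (derivative v).natDegree) h0
      simp only [hP, coeff_add, coeff_mul_C, coeff_zero, coeff_C] at h1
      rw [if_neg (by rw [natDegree_derivative]; omega), zero_add] at h1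
      exact (mul_eq_zero.1 h1).resolve_left (leadingCoeff_ne_zero.2 hv')
    have hx : MvPolynomial.pderiv 0 h = 0 := by
      rw [hP, hy] at h0
      simpa using h0
    obtain ⟨c, hc⟩ := eq_C_of_pderiv_eq_zero hx hy
    exact hh c hc
  have hPW : derivative u * P.comp u = W.comp u := by
    simp only [hP, hW, add_comp, sub_comp, mul_comp, neg_comp, pow_comp, C_comp]
    have h1 := H.trace
    rw [← H.minors]
    rw [hb] at h1 ⊢
    linear_combination ((dY v).comp u) * h1
  have hu' : derivative u ≠ 0 := by
    intro h0
    have := derivative_eq_zero.1 h0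
    omega
  have hPc : P.comp u ≠ 0 := by
    intro h0
    rw [← zero_comp (p := u)] at h0
    exact hP0 (comp_left_cancel hu h0)
  have h2 := congrArg natDegree hPW
  rw [natDegree_mul hu' hPc, natDegree_derivative, natDegree_comp, natDegree_comp] at h2
  have h3 : u.natDegree ∣ u.natDegree - 1 := by
    rw [← Nat.dvd_add_left (dvd_mul_left _ P.natDegree), h2]
    exact dvd_mul_left _ _
  have h4 := Nat.eq_zero_of_dvd_of_lt h3 (by omega)
  omega

/-- Otherwise `u = q z + p`, so `z` can be eliminated in favour of `u` and `u` cancelled from the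
compositions. The resulting linear relations between `v_x`, `v_y`, `v_w` are incompatible with `v_w`
having positive degree in `w`. -/
theorem NilpotentEquations.natDegree_le_one (H : NilpotentEquations u v h) (hu : 1 ≤ u.natDegree)
    (hh : ∀ c, h ≠ MvPolynomial.C c) : v.natDegree ≤ 1 := by
  by_contra hv
  replace hv : 2 ≤ v.natDegree := by omega
  obtain ⟨b, hb⟩ := H.dY_eq_C hu hv
  have hd := H.natDegree_eq_one hu hv hh
  obtain ⟨q, p, huqp⟩ := exists_eq_X_add_C_of_natDegree_le_one hd.le
  have hq : q ≠ 0 := by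
    rintro rfl
    rw [huqp] at hd
    simp at hd
  have htr := H.trace
  have hmin := H.minors
  have hv'lc : (derivative v).coeff (v.natDegree - 1) ≠ 0 := by
    rw [← natDegree_derivative]
    refine leadingCoeff_ne_zero.2 fun h0 => ?_
    have := derivative_eq_zero.1 h0
    omega
  have hdX : dX u = C (MvPolynomial.pderiv 0 q) * X + C (MvPolynomial.pderiv 0 p) := by
    rw [huqp]
    simp only [map_add, Derivation.leibniz, coeffDer_C, coeffDer_X, smul_eq_mul]
    ring
  have hu' : derivative u = C q := by
    rw [huqp]
    simp
  rw [hdX, hb] at htr hmin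
  have hE : C q * (dY v + C b * derivative v + C (MvPolynomial.pderiv 0 p)) -
      C (MvPolynomial.pderiv 0 q) * (C p - X) = 0 := by
    apply comp_left_cancel hu
    simp only [add_comp, sub_comp, mul_comp, C_comp, X_comp, zero_comp]
    linear_combination C q * htr + C (MvPolynomial.pderiv 0 q) * huqp
  have hqx : MvPolynomial.pderiv 0 q = 0 := by
    apply pderiv_eq_zero_of_dvd
    have h1 := congrArg (fun f => f.coeff 1) hE
    simp only [coeff_sub, coeff_C_mul, coeff_X_one, coeff_C_succ, coeff_zero] at h1
    exact ⟨-((dY v + C b * derivative v + C (MvPolynomial.pderiv 0 p)).coeff 1), by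
      linear_combination h1⟩
  rw [hqx] at hE hmin
  replace hE : dY v + C b * derivative v + C (MvPolynomial.pderiv 0 p) = 0 := by
    rw [map_zero, zero_mul, sub_zero, mul_eq_zero] at hE
    exact hE.resolve_left (by simpa using hq)
  have hM : C (MvPolynomial.pderiv 0 p) * dY v - C b * dX v =
      C q * (C (MvPolynomial.pderiv 0 h) + derivative v * C (MvPolynomial.pderiv 1 h)) := by
    apply comp_left_cancel hu
    simp only [add_comp, sub_comp, mul_comp, C_comp]
    rw [hu'] at hmin
    rw [map_zero] at hmin
    linear_combination hmin
  obtain ⟨px, hpx⟩ : ∃ px, px = MvPolynomial.pderiv 0 p := ⟨_, rfl⟩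
  obtain ⟨hx, hhx⟩ : ∃ hx, hx = MvPolynomial.pderiv 0 h := ⟨_, rfl⟩
  obtain ⟨hy, hhy⟩ : ∃ hy, hy = MvPolynomial.pderiv 1 h := ⟨_, rfl⟩
  have hdet := H.det
  rw [← hhx, ← hhy] at hdet hM
  rw [← hpx] at hE hM
  have hn : v.natDegree - 1 ≠ 0 := by omega
  by_cases hy0 : hy = 0
  · have hx0 : hx ≠ 0 := by
      intro hx0
      obtain ⟨c, hc⟩ := eq_C_of_pderiv_eq_zero (hhx.symm.trans hx0) (hhy.symm.trans hy0)
      exact hh c hc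
    rw [hy0, map_zero, mul_zero, eq_comm, mul_eq_zero] at hdet
    have hdY := hdet.resolve_right (by simpa using hx0)
    rw [hdY, zero_add] at hE
    have hb0 : b = 0 := by
      have h1 := congrArg (fun f => f.coeff (v.natDegree - 1)) hE
      simp only [coeff_add, coeff_C_mul, coeff_C, if_neg hn, coeff_zero, add_zero] at h1
      exact (mul_eq_zero.1 h1).resolve_right hv'lc
    rw [hdY, hb0, hy0] at hM
    simp only [map_zero, mul_zero, zero_mul, sub_zero, add_zero] at hM
    rw [eq_comm, mul_eq_zero] at hM
    simp [hq, hx0] at hM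
  -- Eliminating `v_x` and `v_y` leaves `A + B v_w = 0` with `A, B ∈ K[x, y]`, so `A = B = 0`.
  · have hlin : C (q * hy * hx + px * (px * hy - b * hx)) +
        C (q * hy ^ 2 + b * (px * hy - b * hx)) * derivative v = 0 := by
      simp only [map_add, map_mul, map_sub, map_pow]
      linear_combination -C hy * hM - C b * hdet + (C px * C hy - C b * C hx) * hE
    have h1 : q * hy ^ 2 + b * (px * hy - b * hx) = 0 := by
      have h1 := congrArg (fun f => f.coeff (v.natDegree - 1)) hlin
      simp only [coeff_add, coeff_C_mul, coeff_C, if_neg hn, coeff_zero, zero_add] at h1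
      exact (mul_eq_zero.1 h1).resolve_right hv'lc
    rw [h1, map_zero, zero_mul, add_zero, C_eq_zero] at hlin
    have h2 : q * hy * (px * hy - b * hx) = 0 := by
      linear_combination px * h1 - b * hlin
    have h3 := (mul_eq_zero.1 h2).resolve_left (mul_ne_zero hq hy0)
    rw [h3, mul_zero, add_zero] at h1
    exact mul_ne_zero hq (pow_ne_zero 2 hy0) h1

end

/-! ### The coefficient of `w` is constant, and `u` is linear in `z` -/

section

open Polynomial

variable {K : Type*} [Field K] [CharZero K]
  {u v : (MvPolynomial (Fin 2) K)[X]} {h : MvPolynomial (Fin 2) K}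

/-- With `a` the leading coefficient of `u` in `z`, the top coefficients of the trace and minors
equations say that `(a, a c)` is a planar nilpotent pair. By `planar_dependent`, `(α + β c) a` is
constant, which makes `c` constant if `β ≠ 0`. -/
theorem NilpotentEquations.coeff_one_eq_C [IsAlgClosed K] (H : NilpotentEquations u v h)
    (hu : 1 ≤ u.natDegree) (hh : ∀ c, h ≠ MvPolynomial.C c) :
    ∃ c : K, v.coeff 1 = MvPolynomial.C c := by
  obtain ⟨c, v₀, hv⟩ := exists_eq_X_add_C_of_natDegree_le_one (H.natDegree_le_one hu hh)
  have hc : v.coeff 1 = c := by rw [hv]; simp [coeff_C]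
  rw [hc]
  obtain ⟨a, ha⟩ : ∃ a, a = u.leadingCoeff := ⟨_, rfl⟩
  have ha0 : a ≠ 0 := by
    rw [ha]
    refine leadingCoeff_ne_zero.2 ?_
    rintro rfl
    simp at hu
  have hlc : u.coeff u.natDegree = a := ha.symm
  have hdX : dX v = C (MvPolynomial.pderiv 0 c) * X + C (MvPolynomial.pderiv 0 v₀) := by
    rw [hv]
    simp only [map_add, Derivation.leibniz, coeffDer_C, coeffDer_X, smul_eq_mul]
    ring
  have hdY : dY v = C (MvPolynomial.pderiv 1 c) * X + C (MvPolynomial.pderiv 1 v₀) := by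
    rw [hv]
    simp only [map_add, Derivation.leibniz, coeffDer_C, coeffDer_X, smul_eq_mul]
    ring
  have hv' : derivative v = C c := by rw [hv]; simp
  have htr := H.trace
  have hmin := H.minors
  have hdet := H.det
  rw [hdX, hdY] at hdet hmin
  rw [hdY] at htr
  rw [hv'] at htr hmin
  simp only [add_comp, mul_comp, C_comp, X_comp] at htr hmin
  have h1 : MvPolynomial.pderiv 0 a + MvPolynomial.pderiv 1 (a * c) = 0 := by
    have := congrArg (fun p => p.coeff u.natDegree) htr
    simp only [coeff_add, coeff_coeffDer, coeff_C_mul, coeff_C, coeff_zero, hlc] at this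
    rw [if_neg (by omega)] at this
    rw [Derivation.leibniz, smul_eq_mul, smul_eq_mul]
    linear_combination this
  have h2 : MvPolynomial.pderiv 0 a * MvPolynomial.pderiv 1 c =
      MvPolynomial.pderiv 1 a * MvPolynomial.pderiv 0 c := by
    have h3 : C (MvPolynomial.pderiv 1 c) * (dX u * u) - C (MvPolynomial.pderiv 0 c) * (dY u * u) =
        C (MvPolynomial.pderiv 0 h + c * MvPolynomial.pderiv 1 h) * derivative u -
          C (MvPolynomial.pderiv 1 v₀) * dX u + C (MvPolynomial.pderiv 0 v₀) * dY u := by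
      rw [C_add, C_mul]
      linear_combination hmin
    have h4 := congrArg (fun p => p.coeff (u.natDegree + u.natDegree)) h3
    have h5 : (derivative u).coeff (u.natDegree + u.natDegree) = 0 := by
      apply coeff_eq_zero_of_natDegree_lt
      rw [natDegree_derivative]
      omega
    have h6 : u.coeff (u.natDegree + u.natDegree) = 0 :=
      coeff_eq_zero_of_natDegree_lt (by omega)
    simp only [coeff_sub, coeff_add, coeff_C_mul, coeff_coeffDer, h5, h6, map_zero, mul_zero,
      coeff_mul_add_eq_of_natDegree_le (natDegree_coeffDer_le _ u) le_rfl, hlc] at h4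
    have h7 : a * (MvPolynomial.pderiv 0 a * MvPolynomial.pderiv 1 c -
      MvPolynomial.pderiv 1 a * MvPolynomial.pderiv 0 c) = 0 := by linear_combination h4
    exact sub_eq_zero.1 ((mul_eq_zero.1 h7).resolve_left ha0)
  obtain ⟨α, β, e, hαβ, he⟩ := planar_dependent h1 (by
    simp only [Derivation.leibniz, smul_eq_mul]
    linear_combination a * h2)
  have he' : (MvPolynomial.C α + MvPolynomial.C β * c) * a = MvPolynomial.C e := by
    rw [← he]; ring
  by_cases hβ : β = 0
  · rw [hβ, map_zero, zero_mul, add_zero] at he'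
    have hα : α ≠ 0 := by simpa [hβ] using hαβ
    have hα' : (MvPolynomial.C α : MvPolynomial (Fin 2) K) ≠ 0 := by simpa using hα
    have hder (i : Fin 2) : MvPolynomial.pderiv i a = 0 := by
      have := congrArg (MvPolynomial.pderiv i) he'
      rw [MvPolynomial.pderiv_C_mul, MvPolynomial.pderiv_C] at this
      exact (mul_eq_zero.1 this).resolve_left hα'
    have hcy : MvPolynomial.pderiv 1 c = 0 := by
      rw [Derivation.leibniz, hder, hder, smul_zero, zero_add, add_zero, smul_eq_mul] at h1
      exact (mul_eq_zero.1 h1).resolve_left ha0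
    by_cases hcx : MvPolynomial.pderiv 0 c = 0
    · exact eq_C_of_pderiv_eq_zero hcx hcy
    -- Here `h_y = 0` and the minors equation reads `-u_y (c_x u + v₀_x) = u_z h_x`; the left side
    -- has degree at least `d` in `z`, the right side `d - 1`.
    exfalso
    have h3 := congrArg (fun p => p.coeff 1) hdet
    have h4 := congrArg (fun p => p.coeff 0) hdet
    simp only [coeff_mul_C, coeff_add, coeff_C_mul, coeff_X_one, coeff_X_zero, coeff_C_succ,
      coeff_C_zero, hcy, zero_mul, mul_zero, mul_one, add_zero, zero_add] at h3 h4
    have hhy := (mul_eq_zero.1 h3).resolve_left hcx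
    have hhx : MvPolynomial.pderiv 0 h ≠ 0 := by
      intro hhx
      obtain ⟨c, hc⟩ := eq_C_of_pderiv_eq_zero hhx hhy
      exact hh c hc
    rw [hhy, mul_zero, eq_comm, mul_eq_zero] at h4
    have hvy := h4.resolve_right hhx
    rw [hcy, hvy, hhy] at hmin
    simp only [map_zero, zero_mul, add_zero, mul_zero, zero_sub] at hmin
    have hu' : derivative u ≠ 0 := by
      intro h0
      have := derivative_eq_zero.1 h0
      omega
    have hx' : (C (MvPolynomial.pderiv 0 h) : (MvPolynomial (Fin 2) K)[X]) ≠ 0 := by simpa using hhx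
    have hY0 : dY u ≠ 0 := by
      intro h0
      rw [h0, zero_mul, neg_zero, eq_comm] at hmin
      exact mul_ne_zero hu' hx' hmin
    have hcu : (C (MvPolynomial.pderiv 0 c) * u + C (MvPolynomial.pderiv 0 v₀)).natDegree =
        u.natDegree := by
      rw [natDegree_add_C, natDegree_C_mul hcx]
    have h5 := congrArg natDegree hmin
    rw [natDegree_neg, natDegree_mul hY0 (by intro h0; rw [h0, natDegree_zero] at hcu; omega),
      natDegree_mul hu' hx', hcu, natDegree_derivative, natDegree_C] at h5
    omega
  · have hβ' : (MvPolynomial.C β : MvPolynomial (Fin 2) K) ≠ 0 := by simpa using hβ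
    by_cases h0 : MvPolynomial.C α + MvPolynomial.C β * c = 0
    · refine ⟨-α / β, ?_⟩
      apply mul_left_cancel₀ hβ'
      rw [← MvPolynomial.C_mul, mul_div_cancel₀ _ hβ, MvPolynomial.C_neg]
      linear_combination h0
    · have hder (i : Fin 2) : MvPolynomial.pderiv i c = 0 := by
        have h3 := pderiv_eq_zero_of_mul_left (i := i) h0 ha0 (by
          rw [he', MvPolynomial.pderiv_C])
        rw [map_add, MvPolynomial.pderiv_C, zero_add, MvPolynomial.pderiv_C_mul] at h3
        exact (mul_eq_zero.1 h3).resolve_left hβ'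
      exact eq_C_of_pderiv_eq_zero (hder 0) (hder 1)

/-- When `v` does not involve `w`, the polynomial `u` is linear in `z`. -/
theorem NilpotentEquations.linear_of_C {v : MvPolynomial (Fin 2) K}
    (H : NilpotentEquations u (C v) h) (hu : 1 ≤ u.natDegree) (hv : ∀ c, v ≠ MvPolynomial.C c)
    (hvh : ∀ c e, h ≠ MvPolynomial.C c * v + MvPolynomial.C e) :
    ∃ (k : K) (φ : MvPolynomial (Fin 2) K), k ≠ 0 ∧ u = C (MvPolynomial.C k) * X + C φ ∧
      MvPolynomial.pderiv 0 v ≠ 0 ∧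
      MvPolynomial.pderiv 0 v * MvPolynomial.pderiv 1 h =
        MvPolynomial.pderiv 1 v * MvPolynomial.pderiv 0 h ∧
      MvPolynomial.pderiv 0 φ = -MvPolynomial.pderiv 1 v ∧
      MvPolynomial.pderiv 1 φ * MvPolynomial.pderiv 0 v +
        MvPolynomial.C k * MvPolynomial.pderiv 0 h = -MvPolynomial.pderiv 1 v ^ 2 := by
  have htr := H.trace
  have hmin := H.minors
  have hdet := H.det
  simp only [coeffDer_C, C_comp, derivative_C, zero_comp, zero_mul, add_zero] at htr hmin hdet
  rw [← C_mul, ← C_mul, C_inj] at hdet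
  have hx0 : MvPolynomial.pderiv 0 (u.coeff 0) = -MvPolynomial.pderiv 1 v := by
    have := congrArg (fun p => p.coeff 0) htr
    simp only [coeff_add, coeff_coeffDer, coeff_C_zero, coeff_zero] at this
    linear_combination this
  have hxi (i : ℕ) : MvPolynomial.pderiv 0 (u.coeff (i + 1)) = 0 := by
    have := congrArg (fun p => p.coeff (i + 1)) htr
    simpa only [coeff_add, coeff_coeffDer, coeff_C_succ, coeff_zero, add_zero] using this
  have hi (i : ℕ) : MvPolynomial.pderiv 0 (u.coeff i) * MvPolynomial.pderiv 1 v -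
      MvPolynomial.pderiv 1 (u.coeff i) * MvPolynomial.pderiv 0 v =
      u.coeff (i + 1) * (i + 1) * MvPolynomial.pderiv 0 h := by
    have := congrArg (fun p => p.coeff i) hmin
    simpa only [coeff_sub, coeff_mul_C, coeff_coeffDer, coeff_derivative] using this
  have hvx : MvPolynomial.pderiv 0 v ≠ 0 := by
    intro hvx
    have hvy : MvPolynomial.pderiv 1 v ≠ 0 := by
      intro hvy
      obtain ⟨c, hc⟩ := eq_C_of_pderiv_eq_zero hvx hvy
      exact hv c hc
    rw [hvx, zero_mul, eq_comm, mul_eq_zero] at hdet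
    have hhx := hdet.resolve_left hvy
    have h0 := hi 0
    rw [hx0, hvx, hhx, mul_zero, mul_zero, sub_zero] at h0
    exact mul_ne_zero (neg_ne_zero.2 hvy) hvy h0
  obtain ⟨n, hn⟩ : ∃ n, u.natDegree = n + 1 := ⟨u.natDegree - 1, by omega⟩
  have hlc0 : u.coeff (n + 1) ≠ 0 := by
    rw [← hn]
    refine leadingCoeff_ne_zero.2 ?_
    rintro rfl
    simp at hn
  -- In the minors equation the coefficient at the degree of `u` receives nothing from `u_z`, so the
  -- leading coefficient is free of `y` too.
  obtain ⟨k, hk⟩ : ∃ k, u.coeff (n + 1) = MvPolynomial.C k := by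
    refine eq_C_of_pderiv_eq_zero (hxi n) ?_
    have h1 := hi (n + 1)
    rw [hxi, coeff_eq_zero_of_natDegree_lt (n := n + 1 + 1) (by omega), zero_mul, zero_sub,
      zero_mul, zero_mul, neg_eq_zero] at h1
    exact (mul_eq_zero.1 h1).resolve_right hvx
  have hk0 : k ≠ 0 := by
    rintro rfl
    exact hlc0 (by rw [hk, map_zero])
  rcases n with _ | n
  · refine ⟨k, u.coeff 0, hk0, ?_, hvx, hdet, hx0, ?_⟩
    · rw [← hk]
      exact eq_X_add_C_of_natDegree_le_one hn.le
    · have h1 := hi 0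
      rw [hk, hx0] at h1
      push_cast at h1
      linear_combination -h1
  -- For degree `n + 2 ≥ 2`, the coefficient of `z ^ (n + 1)` gives `h_x = w v_x` with `w` free of
  -- `x`. Mixed derivatives of `h` then make `w` constant, so `h` is affine in `v`.
  · exfalso
    obtain ⟨r, hr⟩ : ∃ r : K, r = -(k * (n + 1 + 1))⁻¹ := ⟨_, rfl⟩
    have hrk : (MvPolynomial.C r : MvPolynomial (Fin 2) K) *
        (MvPolynomial.C k * ((n : MvPolynomial (Fin 2) K) + 1 + 1)) = -1 := by
      have h0 : (n : K) + 1 + 1 ≠ 0 := by exact_mod_cast Nat.succ_ne_zero (n + 1)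
      have h1 : r * (k * (n + 1 + 1)) = -1 := by rw [hr]; field_simp
      have := congrArg (MvPolynomial.C (σ := Fin 2)) h1
      simpa using this
    obtain ⟨w, hw⟩ : ∃ w, w = MvPolynomial.pderiv 1 (MvPolynomial.C r * u.coeff (n + 1)) :=
      ⟨_, rfl⟩
    have hhx : MvPolynomial.pderiv 0 h = w * MvPolynomial.pderiv 0 v := by
      have h1 := hi (n + 1)
      rw [hxi, hk] at h1
      push_cast at h1
      rw [hw, MvPolynomial.pderiv_C_mul]
      linear_combination MvPolynomial.C r * h1 + MvPolynomial.pderiv 0 h * hrk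
    have hhy : MvPolynomial.pderiv 1 h = w * MvPolynomial.pderiv 1 v := by
      apply mul_left_cancel₀ hvx
      rw [hdet, hhx]
      ring
    have hwx : MvPolynomial.pderiv 0 w = 0 := by
      rw [hw, pderiv_comm, MvPolynomial.pderiv_C_mul, hxi, mul_zero, map_zero]
    have hwy : MvPolynomial.pderiv 1 w = 0 := by
      have h1 := congrArg (MvPolynomial.pderiv 1) hhx
      rw [← pderiv_comm, hhy, Derivation.leibniz, Derivation.leibniz, hwx, pderiv_comm] at h1
      simp only [smul_eq_mul, mul_zero, add_zero] at h1
      have h2 : MvPolynomial.pderiv 0 v * MvPolynomial.pderiv 1 w = 0 := by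
        linear_combination -h1
      exact (mul_eq_zero.1 h2).resolve_left hvx
    obtain ⟨c, hc⟩ := eq_C_of_pderiv_eq_zero hwx hwy
    obtain ⟨e, he⟩ := eq_C_of_pderiv_eq_zero (f := h - MvPolynomial.C c * v)
      (by rw [map_sub, MvPolynomial.pderiv_C_mul, hhx, hc, sub_self])
      (by rw [map_sub, MvPolynomial.pderiv_C_mul, hhy, hc, sub_self])
    exact hvh c e (by linear_combination he)

end

/-! ### Nilpotent matrices, passage to `K[x, y][z]`, and the linear shear -/

section

theorem det_eq_zero_of_isNilpotent {n R : Type*} [Fintype n] [DecidableEq n] [Nonempty n]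
    [CommRing R] [IsDomain R] {M : Matrix n n R} (hM : IsNilpotent M) : M.det = 0 := by
  obtain ⟨k, hk⟩ := hM
  have := congrArg Matrix.det hk
  rw [Matrix.det_pow, Matrix.det_zero] at this
  exact eq_zero_of_pow_eq_zero this

theorem trace_eq_zero_of_isNilpotent {n R : Type*} [Fintype n] [DecidableEq n]
    [CommRing R] [IsDomain R] {M : Matrix n n R} (hM : IsNilpotent M) : M.trace = 0 :=
  (Matrix.isNilpotent_trace_of_isNilpotent hM).eq_zero

/-- The sum of the principal minors of size two of a nilpotent `3 × 3` matrix vanishes. -/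
theorem minors_eq_zero_of_isNilpotent {R : Type*} [CommRing R] [IsDomain R] [CharZero R]
    {M : Matrix (Fin 3) (Fin 3) R} (hM : IsNilpotent M) :
    M 0 0 * M 1 1 - M 0 1 * M 1 0 + (M 0 0 * M 2 2 - M 0 2 * M 2 0) +
      (M 1 1 * M 2 2 - M 1 2 * M 2 1) = 0 := by
  have h1 := trace_eq_zero_of_isNilpotent hM
  have h2 := trace_eq_zero_of_isNilpotent ((Commute.refl M).isNilpotent_mul_left hM)
  simp only [Matrix.trace_fin_three, Matrix.mul_apply, Fin.sum_univ_three] at h1 h2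
  -- Twice the sum of minors is `(tr M)² - tr M²`.
  have h3 : (2 : R) * (M 0 0 * M 1 1 - M 0 1 * M 1 0 + (M 0 0 * M 2 2 - M 0 2 * M 2 0) +
      (M 1 1 * M 2 2 - M 1 2 * M 2 1)) = 0 := by
    linear_combination (M 0 0 + M 1 1 + M 2 2) * h1 - h2
  exact (mul_eq_zero.1 h3).resolve_left two_ne_zero

open MvPolynomial

variable {K : Type*} [Field K]

/-- A polynomial in `x, y, z` viewed as a polynomial in `z` with coefficients in `K[x, y]`. -/
def toZ : MvPolynomial (Fin 3) K →ₐ[K] Polynomial (MvPolynomial (Fin 2) K) :=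
  aeval ![Polynomial.C (X 0), Polynomial.C (X 1), Polynomial.X]

@[simp]
theorem toZ_C (c : K) : toZ (C c) = Polynomial.C (C c) := by
  simp [toZ, Polynomial.algebraMap_apply]

@[simp]
theorem toZ_X_zero : toZ (X 0 : MvPolynomial (Fin 3) K) = Polynomial.C (X 0) := by simp [toZ]

@[simp]
theorem toZ_X_one : toZ (X 1 : MvPolynomial (Fin 3) K) = Polynomial.C (X 1) := by simp [toZ]

@[simp]
theorem toZ_X_two : toZ (X 2 : MvPolynomial (Fin 3) K) = Polynomial.X := by simp [toZ]

theorem toZ_injective : Function.Injective (toZ (K := K)) := by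
  have h : (Polynomial.eval₂RingHom (aeval ![X 0, X 1] :
      MvPolynomial (Fin 2) K →ₐ[K] MvPolynomial (Fin 3) K).toRingHom (X 2)).comp
      (toZ (K := K)).toRingHom = RingHom.id _ := by
    apply MvPolynomial.ringHom_ext
    · intro c
      simp [algebraMap_eq]
    · intro i
      fin_cases i <;> simp
  exact Function.LeftInverse.injective fun f => DFunLike.congr_fun h f

theorem toZ_pderiv_zero (f : MvPolynomial (Fin 3) K) : toZ (pderiv 0 f) = dX (toZ f) := by
  induction f using MvPolynomial.induction_on with
  | C a => simp
  | add p q hp hq => simp only [map_add, hp, hq]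
  | mul_X p i hp =>
    fin_cases i <;> simp [Derivation.leibniz, hp, pderiv_X]

theorem toZ_pderiv_one (f : MvPolynomial (Fin 3) K) : toZ (pderiv 1 f) = dY (toZ f) := by
  induction f using MvPolynomial.induction_on with
  | C a => simp
  | add p q hp hq => simp only [map_add, hp, hq]
  | mul_X p i hp =>
    fin_cases i <;> simp [Derivation.leibniz, hp, pderiv_X]

theorem toZ_pderiv_two (f : MvPolynomial (Fin 3) K) :
    toZ (pderiv 2 f) = Polynomial.derivative (toZ f) := by
  induction f using MvPolynomial.induction_on with
  | C a => simp
  | add p q hp hq => simp only [map_add, hp, hq]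
  | mul_X p i hp =>
    fin_cases i <;> simp [Derivation.leibniz, hp, pderiv_X] <;> ring

theorem toZ_bind₁ (u v : MvPolynomial (Fin 3) K) :
    toZ (bind₁ ![X 0, X 1, u] v) = (toZ v).comp (toZ u) := by
  induction v using MvPolynomial.induction_on with
  | C a => simp
  | add p q hp hq => simp only [map_add, hp, hq, Polynomial.add_comp]
  | mul_X p i hp =>
    fin_cases i <;> simp [hp]

theorem toZ_bind₁_two (h : MvPolynomial (Fin 2) K) :
    toZ (bind₁ ![X 0, X 1] h) = Polynomial.C h := by
  induction h using MvPolynomial.induction_on with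
  | C a => simp
  | add p q hp hq => simp only [map_add, hp, hq]
  | mul_X p i hp =>
    fin_cases i <;> simp [hp]

theorem eval_zero_eq (f : MvPolynomial (Fin 3) K) : eval 0 f = eval 0 ((toZ f).coeff 0) := by
  rw [Polynomial.coeff_zero_eq_eval_zero]
  induction f using MvPolynomial.induction_on with
  | C a => simp
  | add p q hp hq => simp only [map_add, hp, hq, Polynomial.eval_add]
  | mul_X p i hp =>
    fin_cases i <;> simp

/-- The linear substitution `y ↦ y + c x`. -/
def shear (c : K) : MvPolynomial (Fin 2) K →ₐ[K] MvPolynomial (Fin 2) K :=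
  bind₁ ![X 0, X 1 + C c * X 0]

theorem shear_neg (c : K) (f : MvPolynomial (Fin 2) K) : shear (-c) (shear c f) = f := by
  have : (shear (-c)).comp (shear c) = AlgHom.id K _ := by
    apply MvPolynomial.algHom_ext
    intro i
    fin_cases i <;> simp [shear]
  exact DFunLike.congr_fun this f

theorem shear_injective (c : K) : Function.Injective (shear c) :=
  Function.LeftInverse.injective (shear_neg c)

@[simp]
theorem shear_C (c a : K) : shear c (C a) = C a := by simp [shear]

theorem pderiv_zero_shear (c : K) (f : MvPolynomial (Fin 2) K) :
    pderiv 0 (shear c f) = shear c (pderiv 0 f + C c * pderiv 1 f) := by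
  have := der_aeval (pderiv (R := K) (0 : Fin 2)) (by simp [algebraMap_eq])
    ![X 0, X 1 + C c * X 0] f
  simp [Derivation.leibniz, pderiv_X] at this
  rw [map_add, map_mul, shear_C]
  simp only [shear]
  rw [this]
  ring

theorem pderiv_one_shear (c : K) (f : MvPolynomial (Fin 2) K) :
    pderiv 1 (shear c f) = shear c (pderiv 1 f) := by
  have := der_aeval (pderiv (R := K) (1 : Fin 2)) (by simp [algebraMap_eq])
    ![X 0, X 1 + C c * X 0] f
  simpa [shear, Derivation.leibniz, pderiv_X] using this

theorem eval_zero_shear (c : K) (f : MvPolynomial (Fin 2) K) :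
    eval 0 (shear c f) = eval 0 f := by
  induction f using MvPolynomial.induction_on with
  | C a => simp
  | add p q hp hq => simp only [map_add, hp, hq]
  | mul_X p i hp =>
    fin_cases i <;> simp [shear]

theorem dX_map_shear (c : K) (p : Polynomial (MvPolynomial (Fin 2) K)) :
    dX (p.map (shear c).toRingHom) =
      (dX p + Polynomial.C (C c) * dY p).map (shear c).toRingHom := by
  ext1 n
  simp [pderiv_zero_shear]

theorem dY_map_shear (c : K) (p : Polynomial (MvPolynomial (Fin 2) K)) :
    dY (p.map (shear c).toRingHom) = (dY p).map (shear c).toRingHom := by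
  ext1 n
  simp [pderiv_one_shear]

/-- The change of coordinates `y ↦ y + c x` in dimension three. -/
def shearGL (c : K) : Matrix.GeneralLinearGroup (Fin 3) K where
  val := !![1, 0, 0; c, 1, 0; 0, 0, 1]
  inv := !![1, 0, 0; -c, 1, 0; 0, 0, 1]
  val_inv := by
    ext i j
    fin_cases i <;> fin_cases j <;> simp [Matrix.mul_apply, Fin.sum_univ_three]
  inv_val := by
    ext i j
    fin_cases i <;> fin_cases j <;> simp [Matrix.mul_apply, Fin.sum_univ_three]

theorem toZ_shearGL (c : K) (f : MvPolynomial (Fin 3) K) :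
    toZ (bind₁ (fun k : Fin 3 => ∑ l : Fin 3, C ((shearGL c).val k l) * X l) f) =
      (toZ f).map (shear c).toRingHom := by
  induction f using MvPolynomial.induction_on with
  | C a => simp
  | add p q hp hq => simp only [map_add, hp, hq, Polynomial.map_add]
  | mul_X p i hp =>
    rw [map_mul, map_mul, hp, bind₁_X_right, map_mul, Polynomial.map_mul]
    congr 1
    fin_cases i <;> simp [shearGL, Fin.sum_univ_three, shear, add_comm]

end

/-! ### From the Jacobian matrix to the equations, and back to the normal form -/

section

open MvPolynomial

variable {K : Type*} [Field K]

/-- The Jacobian equations of `mapOf u v h`, with `z` as polynomial variable. -/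
theorem jacobian_equations [CharZero K]
    {u v : MvPolynomial (Fin 3) K} {h : MvPolynomial (Fin 2) K}
    (hnil : IsNilpotent (jacobian (mapOf u v h)))
    {U W : Polynomial (MvPolynomial (Fin 2) K)} (hU : U = toZ u)
    (hW : W = (toZ v).comp (toZ u)) :
    dX U + dY W = 0 ∧
    dX U * dY W - dY U * dX W - Polynomial.derivative U * Polynomial.C (pderiv 0 h) -
      Polynomial.derivative W * Polynomial.C (pderiv 1 h) = 0 ∧
    (dY U * Polynomial.derivative W - Polynomial.derivative U * dY W) *
        Polynomial.C (pderiv 0 h) -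
      (dX U * Polynomial.derivative W - Polynomial.derivative U * dX W) *
        Polynomial.C (pderiv 1 h) = 0 := by
  rw [← toZ_bind₁] at hW
  have hz : Polynomial.derivative (toZ (bind₁ ![X 0, X 1] h)) = 0 := by
    rw [toZ_bind₁_two, Polynomial.derivative_C]
  have hx : dX (toZ (bind₁ ![X 0, X 1] h)) = Polynomial.C (pderiv 0 h) := by
    rw [toZ_bind₁_two, coeffDer_C]
  have hy : dY (toZ (bind₁ ![X 0, X 1] h)) = Polynomial.C (pderiv 1 h) := by
    rw [toZ_bind₁_two, coeffDer_C]
  have h1 := congrArg toZ (trace_eq_zero_of_isNilpotent hnil)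
  have h2 := congrArg toZ (minors_eq_zero_of_isNilpotent hnil)
  have h3 := congrArg toZ (det_eq_zero_of_isNilpotent hnil)
  rw [Matrix.trace_fin_three] at h1
  rw [Matrix.det_fin_three] at h3
  simp only [jacobian, mapOf, Matrix.of_apply, Matrix.cons_val_zero, Matrix.cons_val_one,
    Matrix.cons_val, map_add, map_sub, map_mul, map_zero, toZ_pderiv_zero, toZ_pderiv_one,
    toZ_pderiv_two, ← hU, ← hW, hx, hy, hz] at h1 h2 h3
  exact ⟨by linear_combination h1, by linear_combination h2, by linear_combination h3⟩

/-- Since `H(0) = 0`, a combination of the components that is constant is zero. -/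
theorem eq_zero_of_combination {u v : MvPolynomial (Fin 3) K} {h : MvPolynomial (Fin 2) K}
    (hzero : ∀ i, eval 0 (mapOf u v h i) = 0) (hind : LinearIndependent K (mapOf u v h))
    {α β γ e : K} (hc : Polynomial.C (C α) * toZ u + Polynomial.C (C β) * (toZ v).comp (toZ u) +
      Polynomial.C (C γ * h) = Polynomial.C (C e)) : α = 0 ∧ β = 0 ∧ γ = 0 := by
  have h1 : C α * u + C β * bind₁ ![X 0, X 1, u] v + C γ * bind₁ ![X 0, X 1] h = C e := by
    apply toZ_injective
    simp only [map_add, map_mul, toZ_C, toZ_bind₁, toZ_bind₁_two]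
    rw [← hc, Polynomial.C_mul]
  have h2 : ∑ i, ![α, β, γ] i • mapOf u v h i = C e := by
    rw [← h1]
    simp [Fin.sum_univ_three, mapOf, smul_eq_C_mul]
  have he : e = 0 := by
    have := congrArg (eval 0) h2
    simpa only [map_sum, smul_eq_C_mul, map_mul, hzero, mul_zero, Finset.sum_const_zero, eval_C]
      using this.symm
  rw [he, map_zero] at h2
  have h3 := Fintype.linearIndependent_iff.1 hind _ h2
  exact ⟨h3 0, h3 1, h3 2⟩

/-- If `u` were free of `z`, the first two components would be a planar nilpotent pair, hence
dependent up to a constant. -/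
theorem one_le_natDegree_toZ [CharZero K] [IsAlgClosed K]
    {u v : MvPolynomial (Fin 3) K} {h : MvPolynomial (Fin 2) K}
    (hzero : ∀ i, eval 0 (mapOf u v h i) = 0) (hind : LinearIndependent K (mapOf u v h))
    (hnil : IsNilpotent (jacobian (mapOf u v h))) : 1 ≤ (toZ u).natDegree := by
  by_contra hd
  obtain ⟨f, hf⟩ : ∃ f, toZ u = Polynomial.C f :=
    ⟨_, Polynomial.eq_C_of_natDegree_eq_zero (by omega)⟩
  obtain ⟨g, hg⟩ : ∃ g, (toZ v).comp (toZ u) = Polynomial.C g := ⟨_, by rw [hf, Polynomial.comp_C]⟩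
  obtain ⟨h1, h2, -⟩ := jacobian_equations hnil hf.symm hg.symm
  simp only [coeffDer_C, Polynomial.derivative_C, zero_mul, sub_zero, ← Polynomial.C_mul,
    ← Polynomial.C_add, ← Polynomial.C_sub, Polynomial.C_eq_zero] at h1 h2
  obtain ⟨α, β, e, hαβ, he⟩ := planar_dependent h1 (sub_eq_zero.1 h2)
  have := eq_zero_of_combination hzero hind (α := α) (β := β) (γ := 0) (e := e) (by
    rw [hg, hf, ← he]
    simp)
  simp [this.1, this.2.1] at hαβ

/-- After the chain rule the determinant is `u_z` times a polynomial composed with `u`; both can be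
cancelled as `u` involves `z`. -/
theorem nilpotentEquations_toZ [CharZero K]
    {u v : MvPolynomial (Fin 3) K} {h : MvPolynomial (Fin 2) K}
    (hu : 1 ≤ (toZ u).natDegree)
    (hnil : IsNilpotent (jacobian (mapOf u v h))) : NilpotentEquations (toZ u) (toZ v) h := by
  obtain ⟨h1, h2, h3⟩ := jacobian_equations hnil rfl rfl
  rw [coeffDer_comp, Polynomial.derivative_comp] at h2 h3
  rw [coeffDer_comp] at h1 h2 h3
  refine ⟨by rw [← h1]; ring, by linear_combination h2, ?_⟩
  apply comp_left_cancel hu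
  have hu' : Polynomial.derivative (toZ u) ≠ 0 := by
    intro h0
    have := Polynomial.derivative_eq_zero.1 h0
    omega
  apply mul_left_cancel₀ hu'
  simp only [Polynomial.mul_comp, Polynomial.C_comp]
  linear_combination h3

/-- On sheared polynomials `∂_x` acts as `∂_x + c ∂_y`, which absorbs exactly the terms coming from
`v_w = c`. -/
theorem NilpotentEquations.map_shear {u v : Polynomial (MvPolynomial (Fin 2) K)}
    {h v₀ : MvPolynomial (Fin 2) K} {c : K} (H : NilpotentEquations u v h)
    (hv : v = Polynomial.C (C c) * Polynomial.X + Polynomial.C v₀) :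
    NilpotentEquations (u.map (shear c).toRingHom) (Polynomial.C (shear c v₀)) (shear c h) := by
  have hdX : dX v = Polynomial.C (pderiv 0 v₀) := by
    rw [hv]; simp [Derivation.leibniz]
  have hdY : dY v = Polynomial.C (pderiv 1 v₀) := by
    rw [hv]; simp [Derivation.leibniz]
  have hv' : Polynomial.derivative v = Polynomial.C (C c) := by rw [hv]; simp
  have h1 := H.trace
  have h2 := H.minors
  have h3 := H.det
  rw [hdX, hdY] at h2 h3
  rw [hdY] at h1
  rw [hv'] at h1 h2
  simp only [Polynomial.C_comp] at h1 h2
  have hC (f : MvPolynomial (Fin 2) K) : Polynomial.C (shear c f) =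
      (Polynomial.C f).map (shear c).toRingHom := by simp
  refine ⟨?_, ?_, ?_⟩
  · simp only [coeffDer_C, Polynomial.C_comp, Polynomial.derivative_C, Polynomial.zero_comp,
      zero_mul, add_zero, dX_map_shear, pderiv_one_shear]
    rw [hC, ← Polynomial.map_add, ← Polynomial.map_zero (shear c).toRingHom]
    refine congrArg (Polynomial.map _) ?_
    linear_combination h1
  · simp only [coeffDer_C, Polynomial.C_comp, Polynomial.derivative_C, Polynomial.zero_comp,
      zero_mul, add_zero, dX_map_shear, dY_map_shear, pderiv_zero_shear, pderiv_one_shear,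
      Polynomial.derivative_map]
    simp only [hC, ← Polynomial.map_mul, ← Polynomial.map_sub]
    refine congrArg (Polynomial.map _) ?_
    simp only [Polynomial.C_add, Polynomial.C_mul]
    linear_combination h2
  · simp only [coeffDer_C, pderiv_zero_shear, pderiv_one_shear]
    simp only [hC, ← Polynomial.map_mul]
    refine congrArg (Polynomial.map _) ?_
    simp only [Polynomial.C_add, Polynomial.C_mul]
    linear_combination h3

theorem toZ_conj_shearGL {K : Type*} [Field K] (c : K) (H : PolyMap K) (i : Fin 3) :
    toZ (conj (shearGL c) H i) = ∑ j, Polynomial.C (C ((shearGL c)⁻¹.val i j)) *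
      (toZ (H j)).map (shear c).toRingHom := by
  simp only [conj, map_sum, map_mul, toZ_C, toZ_shearGL]

theorem hasNormalForm_of_toZ {K : Type*} [Field K] {H : PolyMap K} {v h φ : MvPolynomial (Fin 2) K}
    {k S L l : K} {G : Polynomial K} (hk : k ≠ 0) (hS : S ≠ 0) (hG : G.eval 0 = 0)
    (hGd : 1 ≤ G.natDegree)
    (h0 : toZ (H 0) = Polynomial.C (C k) * Polynomial.X + Polynomial.C φ)
    (h1 : toZ (H 1) = Polynomial.C v) (h2 : toZ (H 2) = Polynomial.C h)
    (hv : v = Polynomial.aeval (X 0 - C S * X 1 ^ 2 - C L * X 1) G)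
    (hφ : φ = (C (2 * S) * X 1 + C L) * v - C (k * l) * X 1)
    (hh : h = C (-S / k) * v ^ 2 + C l * v) : HasNormalForm H := by
  have hs : toZ (C 1 * X 0 + Polynomial.aeval (X 1)
      (Polynomial.C (-S) * Polynomial.X ^ 2 + Polynomial.C (-L) * Polynomial.X +
        Polynomial.C (0 : K))) =
      Polynomial.C (X 0 - C S * X 1 ^ 2 - C L * X 1) := by
    simp [algebraMap_eq]
    ring
  have hsG : toZ (Polynomial.aeval (C 1 * X 0 + Polynomial.aeval (X 1)
      (Polynomial.C (-S) * Polynomial.X ^ 2 + Polynomial.C (-L) * Polynomial.X +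
        Polynomial.C (0 : K))) G) = Polynomial.C v := by
    rw [← Polynomial.aeval_algHom_apply, hs, hv]
    exact Polynomial.aeval_algHom_apply (Polynomial.CAlgHom (R := K)
      (A := MvPolynomial (Fin 2) K)) _ _
  have hkS : k * (-S / k) * 1 = -S := by field_simp
  -- With `a = 1` and `b = -S y² - L y`, one has `-b' = 2 S y + L`; no constant term of `b` is
  -- needed.
  refine ⟨k, -S / k, 1, -L, l, 0, G, _, _, hk, div_ne_zero (neg_ne_zero.2 hS) hk, one_ne_zero, hG,
    hGd, (by rw [hkS]), rfl, ?_, ?_, ?_⟩ <;> apply toZ_injective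
  · simp only [map_sub, map_mul, hsG, h0, hφ]
    have h3 : Polynomial.C (C (2 : K)) = (2 : Polynomial (MvPolynomial (Fin 2) K)) := by
      rw [map_ofNat C 2, map_ofNat Polynomial.C 2]
    simp [algebraMap_eq]
    rw [h3]
    ring
  · rw [hsG, h1]
  · simp only [map_add, map_mul, map_pow, h1, h2, toZ_C, hh]

end

end

end NilpJac

/- The degree hypothesis is not needed: level curves of constant curvature are parabolas whatever
the degrees of `v` and `h` are. -/
open MvPolynomial NilpJac in
theorem theorem3p3 {K : Type*} [Field K] [IsAlgClosed K] [CharZero K]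
    (u v : MvPolynomial (Fin 3) K) (h : MvPolynomial (Fin 2) K)
    (hzero : ∀ i, MvPolynomial.eval 0 (NilpJac.mapOf u v h i) = 0)
    (hind : LinearIndependent K (NilpJac.mapOf u v h))
    (hnil : IsNilpotent (NilpJac.jacobian (NilpJac.mapOf u v h)))
    (hdeg : Nat.gcd (NilpJac.atZero v).totalDegree h.totalDegree ≤ 3) :
    ∃ T : Matrix.GeneralLinearGroup (Fin 3) K,
      NilpJac.HasNormalForm (NilpJac.conj T (NilpJac.mapOf u v h)) := by
  have hu := one_le_natDegree_toZ hzero hind hnil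
  have H := nilpotentEquations_toZ hu hnil
  have hh : ∀ c, h ≠ C c := fun c hc => by
    have := eq_zero_of_combination hzero hind (α := 0) (β := 0) (γ := 1) (e := c) (by simp [hc])
    simp at this
  obtain ⟨c, hc⟩ := H.coeff_one_eq_C hu hh
  obtain ⟨v₀, hv₀⟩ : ∃ v₀, v₀ = (toZ v).coeff 0 := ⟨_, rfl⟩
  have hv : toZ v = Polynomial.C (C c) * Polynomial.X + Polynomial.C v₀ := by
    rw [← hc, hv₀]
    exact Polynomial.eq_X_add_C_of_natDegree_le_one (H.natDegree_le_one hu hh)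
  have hW : (toZ v).comp (toZ u) = Polynomial.C (C c) * toZ u + Polynomial.C v₀ := by
    rw [hv]
    simp
  have hinv := shear_neg c
  have hvc : ∀ e, shear c v₀ ≠ C e := fun e he => by
    have h1 : v₀ = C e := by rw [← hinv v₀, he, shear_C]
    -- `v₀` is the second component minus `c` times the first.
    have := eq_zero_of_combination hzero hind (α := -c) (β := 1) (γ := 0) (e := e) (by
      rw [hW, h1]
      simp only [map_neg, map_one, map_zero, zero_mul, one_mul, add_zero]
      ring)
    simp at this
  have hvh : ∀ a e, shear c h ≠ C a * shear c v₀ + C e := fun a e he => by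
    have h1 : h = C a * v₀ + C e := by
      rw [← hinv h, he, map_add, map_mul, hinv, shear_C, shear_C]
    have := eq_zero_of_combination hzero hind (α := a * c) (β := -a) (γ := 1) (e := e) (by
      rw [hW, h1]
      simp
      ring)
    simp at this
  obtain ⟨k, φ, hk, huk, hvx, hvh', hφx, hφy⟩ := (H.map_shear hv).linear_of_C
    (by rwa [Polynomial.natDegree_map_eq_of_injective (shear_injective c)]) hvc hvh
  obtain ⟨S, L, l, e₁, e₂, G, hG, hφ, hhG⟩ := exists_normal_data hk hvx hvh' hφx hφy
  have hu0 : eval 0 ((toZ u).coeff 0) = 0 := by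
    rw [← eval_zero_eq]
    exact hzero 0
  have hv0 : eval 0 (shear c v₀) = 0 := by
    have h1 := hzero 1
    change eval 0 (bind₁ ![X 0, X 1, u] v) = 0 at h1
    rw [eval_zero_eq, toZ_bind₁, hW, Polynomial.coeff_add, Polynomial.coeff_C_mul,
      Polynomial.coeff_C_zero, map_add, map_mul, hu0, mul_zero, zero_add] at h1
    rwa [eval_zero_shear]
  have hh0 : eval 0 (shear c h) = 0 := by
    have h1 := hzero 2
    change eval 0 (bind₁ ![X 0, X 1] h) = 0 at h1
    rw [eval_zero_eq, toZ_bind₁_two, Polynomial.coeff_C_zero] at h1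
    rwa [eval_zero_shear]
  have hφ0 : eval 0 φ = 0 := by
    have h1 := congrArg (fun p => eval 0 (p.coeff 0)) huk
    simpa only [Polynomial.coeff_map, Polynomial.coeff_add, Polynomial.mul_coeff_zero,
      Polynomial.coeff_X_zero, mul_zero, zero_add, Polynomial.coeff_C_zero, AlgHom.toRingHom_eq_coe,
      RingHom.coe_coe, eval_zero_shear, hu0, eq_comm] using h1
  have he₁ : e₁ = 0 := by
    have h1 := congrArg (eval 0) hφ
    simp only [map_add, map_sub, map_mul, hφ0, hv0, eval_C, eval_X, Pi.zero_apply] at h1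
    linear_combination -h1
  have he₂ : e₂ = 0 := by
    have h1 := congrArg (eval 0) hhG
    simp only [map_add, map_mul, map_pow, hh0, hv0, eval_C] at h1
    linear_combination -h1
  rw [he₁, map_zero, add_zero] at hφ
  -- For `S = 0` the third component would be affine in `v`, against linear independence.
  have hS : S ≠ 0 := by
    rintro rfl
    exact hvh l e₂ (by rw [hhG]; simp)
  rw [he₂, map_zero, add_zero] at hhG
  have hG0 : G.eval 0 = 0 := by
    have h1 := congrArg (eval 0) hG
    rw [hv0, ← MvPolynomial.coe_aeval_eq_eval, RingHom.coe_coe, ← Polynomial.aeval_algHom_apply]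
      at h1
    simpa [Polynomial.coe_aeval_eq_eval] using h1.symm
  have hGd : 1 ≤ G.natDegree := by
    by_contra hd
    have h1 := Polynomial.eq_C_of_natDegree_eq_zero (p := G) (by omega)
    rw [h1, Polynomial.aeval_C] at hG
    exact hvc _ hG
  -- On the source `shearGL c` is the shear; on the target its inverse subtracts `c` times the first
  -- component from the second, which removes `c u`.
  refine ⟨shearGL c, hasNormalForm_of_toZ hk hS hG0 hGd (v := shear c v₀) (h := shear c h) (φ := φ)
    ?_ ?_ ?_ hG hφ hhG⟩
  all_goals rw [toZ_conj_shearGL, Fin.sum_univ_three]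
  · rw [← huk]
    simp [mapOf, shearGL]
  · simp [mapOf, shearGL, toZ_bind₁, hW]
    ring
  · simp [mapOf, shearGL, toZ_bind₁_two]
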